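/- Consider a two-armed Bernoulli bandit with means $0<\mu_2<\mu_1<1$. Let $A_1,R_1,A_2,R_2,\dots$ be the arms pulled and the $\{0,1\}$-valued rewards received, where given $H_t=(A_1,R_1,\dots,A_{t-1},R_{t-1})$ and $A_t$ the reward $R_t$ is Bernoulli with parameter $\mu_{A_t}$. Assume that the arms are chosen by UCB: almost surely, at each time $t\ge1$, $A_t$ is an arm $a$ that maximizes the index $$\hat\mu_a(t)+\sqrt{\frac{2\log t}{N_a(t)}}$$ (equal to $+\infty$ if $N_a(t)=0$), where $N_a(t)$ is the number of pulls of arm $a$ at times $1,\dots,t-1$ and $\hat\mu_a(t)$ is the average of the rewards of these pulls; ties are broken arbitrarily, possibly at random. Let $\tau_1=\inf\{t\ge1:A_t=2\}$ and $\tau_{k+1}=\inf\{t>\tau_k:A_t=2,\ A_{t-1}=1\}$ be the starting times of the exploration episodes. For events $(E_t)_{t\ge1}$, let $E_{\tau_k}$ be the event that $\tau_k<\infty$ and $E_t$ holds for $t=\tau_k$. Then for every integer $T\ge0$: 1. UCB has the worst possible sliding regret: almost surely, $$\mathrm{SliReg}(T):=\limsup_{t\to\infty}\Big(T\mu_1-\sum_{i=1}^T\mu_{A_{t+i}}\Big)=T(\mu_1-\mu_2),$$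 while the same upper limit, taken along any sequence of arms whatsoever, is at most $T(\mu_1-\mu_2)$. 2. There are events $(E_t)_{t\ge1}$ with $E_t\in\sigma(H_t)$, such that $\Pr(\liminf_k E_{\tau_k})=1$ and, for all events $(U_t)_{t\ge1}$ with $U_t\in\sigma(H_t)$ and all $k\ge1$ with $\Pr(E_{\tau_k}\cap U_{\tau_k})>0$, $$\Pr\big(\tau_k<\infty,\ A_{\tau_k+i}=2\text{ for all }0\le i<T\;\big|\;E_{\tau_k}\cap U_{\tau_k}\big)\ge\mu_2^T .$$ 3. Almost surely, there are infinitely many $k$ such that $\tau_k<\infty$ and $A_{\tau_k+i}=2$ for all $0\le i<T$. -/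

import Mathlib

open MeasureTheory ProbabilityTheory Filter

noncomputable section

namespace Bandit

/-- The two arms. Arm `1` of the text is `0 : Fin 2`, arm `2` of the text is `1 : Fin 2`. -/
abbrev Arm : Type := Fin 2

/-- The optimal mean `μ* = max_a μ_a`. -/
def optMean (μ : Arm → ℝ) : ℝ := max (μ 0) (μ 1)

/-- Sliding regret of the sequence of arms `a 1, a 2, …`:
`limsup_{t → ∞} (T μ* - ∑_{i=1}^T μ_{a_{t+i}})`. -/
def slidingRegret (μ : Arm → ℝ) (a : ℕ → Arm) (T : ℕ) : ℝ :=
  limsup (fun t : ℕ => (T : ℝ) * optMean μ - ∑ i ∈ Finset.Icc 1 T, μ (a (t + i))) atTop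

/-- The number of visits `N_b(t) = #{1 ≤ i ≤ t - 1 : a_i = b}`. -/
def visits (a : ℕ → Arm) (b : Arm) (t : ℕ) : ℕ :=
  ((Finset.Ico 1 t).filter fun i => a i = b).card

/-- The sum of the rewards obtained from arm `b` at times `1, …, t - 1`
(the number of successes, as rewards are `0` or `1`). -/
def successes (a : ℕ → Arm) (r : ℕ → ℝ) (b : Arm) (t : ℕ) : ℝ :=
  ∑ i ∈ (Finset.Ico 1 t).filter (fun i => a i = b), r i

/-- The empirical mean of arm `b` at time `t` (only used when `N_b(t) > 0`). -/
def empMean (a : ℕ → Arm) (r : ℕ → ℝ) (b : Arm) (t : ℕ) : ℝ :=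
  successes a r b t / visits a b t

/-- The UCB index `μ̂_b(t) + √(2 log t / N_b(t))`, which is `+∞` when `N_b(t) = 0`. -/
def ucbIndex (a : ℕ → Arm) (r : ℕ → ℝ) (b : Arm) (t : ℕ) : EReal :=
  if visits a b t = 0 then ⊤
  else ((empMean a r b t + √(2 * Real.log t / visits a b t) : ℝ) : EReal)

/-- The exploration episodes of a sequence of arms, numbered from `0`:
`explorationTime a 0 = inf {t ≥ 1 : a_t = 2}` and
`explorationTime a (k + 1) = inf {t > explorationTime a k : a_t = 2, a_{t-1} = 1}`,
the infimum of the empty set being `∞`. -/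
def explorationTime (a : ℕ → Arm) : ℕ → ℕ∞
  | 0 => ⨅ (t : ℕ) (_ : 1 ≤ t ∧ a t = 1), (t : ℕ∞)
  | k + 1 => ⨅ (t : ℕ) (_ : explorationTime a k < t ∧ a t = 1 ∧ a (t - 1) = 0), (t : ℕ∞)

variable {Ω : Type*}

/-- `σ(H_t)`, the σ-algebra generated by the history `H_t = (A_1, R_1, …, A_{t-1}, R_{t-1})`. -/
abbrev historySigma (A : ℕ → Ω → Arm) (R : ℕ → Ω → ℝ) (t : ℕ) : MeasurableSpace Ω :=
  ⨆ i ∈ Finset.Ico 1 t,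
    MeasurableSpace.comap (A i) inferInstance ⊔ MeasurableSpace.comap (R i) inferInstance

/-- `(A_t, R_t)_{t ≥ 1}` is the run of some (possibly randomized) policy on the Bernoulli bandit
with means `μ`: rewards are `0` or `1`, and given the history `H_t` and the chosen arm `A_t`,
the reward `R_t` is Bernoulli with parameter `μ_{A_t}`. The index `0` is not used. -/
structure IsBernoulliBanditRun [MeasurableSpace Ω] (P : Measure Ω) (μ : Arm → ℝ)
    (A : ℕ → Ω → Arm) (R : ℕ → Ω → ℝ) : Prop where
  measurable_arm : ∀ t, 1 ≤ t → Measurable (A t)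
  measurable_reward : ∀ t, 1 ≤ t → Measurable (R t)
  reward_zero_or_one : ∀ t, 1 ≤ t → ∀ᵐ ω ∂P, R t ω = 0 ∨ R t ω = 1
  reward_law : ∀ t, 1 ≤ t →
    P⟦R t ⁻¹' {1} | historySigma A R t ⊔ MeasurableSpace.comap (A t) inferInstance⟧
      =ᵐ[P] fun ω => μ (A t ω)

/-- `(A_t, R_t)_{t ≥ 1}` is a run of UCB: it is a run on the bandit in which, at every time
`t ≥ 1`, an arm of maximal index is picked. Ties may be broken in any way, also at random. -/
structure IsUCBRun [MeasurableSpace Ω] (P : Measure Ω) (μ : Arm → ℝ)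
    (A : ℕ → Ω → Arm) (R : ℕ → Ω → ℝ) : Prop extends IsBernoulliBanditRun P μ A R where
  picks_max : ∀ t, 1 ≤ t → ∀ᵐ ω ∂P, ∀ b : Arm,
    ucbIndex (fun i => A i ω) (fun i => R i ω) b t
      ≤ ucbIndex (fun i => A i ω) (fun i => R i ω) (A t ω) t

/-- The random time `τ_{k+1}` at which exploration episode number `k` (from `0`) starts. -/
def episode (A : ℕ → Ω → Arm) (k : ℕ) (ω : Ω) : ℕ∞ :=
  explorationTime (fun t => A t ω) k

/-- For a sequence of events `(E_t)` and a random time `σ`, the event `E_σ`: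
`σ` is finite, and `E_t` holds for `t = σ`. -/
def eventAt (E : ℕ → Set Ω) (σ : Ω → ℕ∞) : Set Ω :=
  {ω | ∃ t : ℕ, σ ω = t ∧ ω ∈ E t}

/-- The event that arm `2` is pulled at each of the `T` times `t, t + 1, …, t + T - 1`. -/
def badStretch (A : ℕ → Ω → Arm) (T t : ℕ) : Set Ω :=
  {ω | ∀ i < T, A (t + i) ω = 1}

end Bandit

end

/-! Call arm `0` optimal and arm `1` bad. If the optimal arm was picked just before a late episode,
its index, close to `μ 0`, was the larger one, so the empirical mean plus the bonus of the bad arm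
is at most about `μ 0 < 1`. On top of `n` visits, `i` rewards `1` raise the bad mean by (1 -
mean)·i/(n+i) and lower its bonus by at most bonus·i/(n+i). The net effect is a gain of order
i/(n+i). Meanwhile the optimal bonus rises by only O(i/t), which is less because n = O(log t). So
UCB keeps pulling the bad arm as long as it yields `1` (`eventually_goodStart`, `GoodStart.pulls`),
and `T` such rewards have conditional probability `μ 1 ^ T`.

These estimates need consistent empirical means under adaptive sampling:
`IsBernoulliBanditRun.ae_tendsto_empMean`, proved with an L²-bounded martingale and Kronecker's
lemma.

`GoodStart` depends on the history only, so the bound holds conditionally on any past event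
(`IsUCBRun.pow_mul_measureReal_eventAt_le`). With "all earlier episodes since number `K` were
interrupted" as past event, `n` consecutive well-started episodes are all interrupted with
probability at most `(1 - μ 1 ^ T) ^ n`. Hence infinitely many episodes last, and each gives a
window of maximal regret. -/

noncomputable section

namespace Bandit

open scoped Topology

/-! ### Pathwise analysis of UCB. -/

section Deterministic

variable (a : ℕ → Arm) (r : ℕ → ℝ) (b : Arm)

theorem arm_eq_one_of_ne_zero {x : Arm} (h : x ≠ 0) : x = 1 := by
  revert h; revert x; decide

theorem visits_succ {t : ℕ} (ht : 1 ≤ t) :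
    visits a b (t + 1) = visits a b t + if a t = b then 1 else 0 := by
  unfold visits
  rw [← Finset.insert_Ico_right_eq_Ico_add_one ht, Finset.filter_insert]
  split_ifs with h
  · rw [Finset.card_insert_of_notMem (by simp)]
  · rfl

theorem successes_succ {t : ℕ} (ht : 1 ≤ t) :
    successes a r b (t + 1) = successes a r b t + if a t = b then r t else 0 := by
  unfold successes
  rw [← Finset.insert_Ico_right_eq_Ico_add_one ht, Finset.filter_insert]
  split_ifs with h
  · rw [Finset.sum_insert (by simp), add_comm]
  · simp

theorem visits_one : visits a b 1 = 0 := by simp [visits]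

theorem visits_mono : Monotone (visits a b) := fun _ _ h =>
  Finset.card_le_card (Finset.filter_subset_filter _ (Finset.Ico_subset_Ico_right h))

theorem visits_add_visits {t : ℕ} (ht : 1 ≤ t) : visits a 0 t + visits a 1 t + 1 = t := by
  induction t, ht using Nat.le_induction with
  | base => simp [visits_one]
  | succ t ht ih =>
    rw [visits_succ a 0 ht, visits_succ a 1 ht]
    rcases eq_or_ne (a t) 0 with h | h
    · simp [h]; omega
    · simp [arm_eq_one_of_ne_zero h]; omega

variable {a r}

theorem successes_nonneg (hr : ∀ t, 1 ≤ t → r t = 0 ∨ r t = 1) (t : ℕ) :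
    0 ≤ successes a r b t := by
  refine Finset.sum_nonneg fun i hi => ?_
  rcases hr i (by simp at hi; omega) with h | h <;> simp [h]

theorem successes_le_visits (hr : ∀ t, 1 ≤ t → r t = 0 ∨ r t = 1) (t : ℕ) :
    successes a r b t ≤ visits a b t := by
  unfold successes visits
  rw [Finset.card_eq_sum_ones, Nat.cast_sum]
  refine Finset.sum_le_sum fun i hi => ?_
  rcases hr i (by simp at hi; omega) with h | h <;> simp [h]

theorem empMean_nonneg (hr : ∀ t, 1 ≤ t → r t = 0 ∨ r t = 1) (t : ℕ) :
    0 ≤ empMean a r b t :=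
  div_nonneg (successes_nonneg b hr t) (Nat.cast_nonneg _)

theorem empMean_le_one (hr : ∀ t, 1 ≤ t → r t = 0 ∨ r t = 1) (t : ℕ) :
    empMean a r b t ≤ 1 :=
  div_le_one_of_le₀ (successes_le_visits b hr t) (Nat.cast_nonneg _)

/-- The real-valued index, meaningful for arms that have been visited. -/
def realIndex (a : ℕ → Arm) (r : ℕ → ℝ) (b : Arm) (t : ℕ) : ℝ :=
  empMean a r b t + √(2 * Real.log t / visits a b t)

theorem ucbIndex_of_visits_ne_zero {b : Arm} {t : ℕ} (h : visits a b t ≠ 0) :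
    ucbIndex a r b t = (realIndex a r b t : EReal) := by
  simp [ucbIndex, realIndex, h]

theorem realIndex_le_of_ucbIndex_le {b c : Arm} {t : ℕ} (hc : visits a c t ≠ 0)
    (h : ucbIndex a r b t ≤ ucbIndex a r c t) :
    visits a b t ≠ 0 ∧ realIndex a r b t ≤ realIndex a r c t := by
  rw [ucbIndex_of_visits_ne_zero hc] at h
  by_cases hb : visits a b t = 0
  · simp [ucbIndex, hb] at h
  · rw [ucbIndex_of_visits_ne_zero hb] at h
    exact ⟨hb, by exact_mod_cast h⟩

theorem tendsto_log_div_atTop : Tendsto (fun t : ℕ => Real.log t / t) atTop (𝓝 0) := by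
  have := (Real.isLittleO_log_id_atTop.tendsto_div_nhds_zero).comp tendsto_natCast_atTop_atTop
  simpa [Function.comp_def] using this

theorem tendsto_log_natCast : Tendsto (fun t : ℕ => Real.log t) atTop atTop :=
  Real.tendsto_log_atTop.comp tendsto_natCast_atTop_atTop

/-- Under UCB every arm is visited infinitely often. -/
theorem tendsto_visits (hr : ∀ t, 1 ≤ t → r t = 0 ∨ r t = 1)
    (hmax : ∀ t, 1 ≤ t → ∀ b, ucbIndex a r b t ≤ ucbIndex a r (a t) t) :
    Tendsto (visits a b) atTop atTop := by
  refine tendsto_atTop_atTop_of_monotone (visits_mono a b) ?_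
  by_contra! hcon
  obtain ⟨B, hB⟩ := hcon
  -- With fewer than `B` visits to `b` for ever, the other arm would have at least t/2 visits and an
  -- index at most 1 + 1, below the bonus of `b`. Then `b` would be pulled at all late times.
  have key : ∀ᶠ t : ℕ in atTop, a t = b := by
    have h4 := tendsto_log_div_atTop.eventually (gt_mem_nhds (show (0 : ℝ) < 1 / 4 by norm_num))
    have hl := tendsto_log_natCast.eventually_ge_atTop (4 * (B + 1) : ℝ)
    filter_upwards [h4, hl, eventually_ge_atTop (2 * (B + 1) + 1)] with t h4 hl ht
    by_contra hne
    have ht0 : (0 : ℝ) < t := by exact_mod_cast (by omega : 0 < t)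
    have hsum := visits_add_visits a (t := t) (by omega)
    have hbB := hB t
    have hother : visits a (a t) t + visits a b t + 1 = t := by
      rcases eq_or_ne b 0 with hb | hb
      · subst hb; rw [arm_eq_one_of_ne_zero hne]; omega
      · have hb1 := arm_eq_one_of_ne_zero hb
        subst hb1
        have : a t = 0 := by by_contra h; exact hne (arm_eq_one_of_ne_zero h)
        rw [this]; omega
    obtain ⟨hb0, hle⟩ := realIndex_le_of_ucbIndex_le (by omega) (hmax t (by omega) b)
    have hc : √(2 * Real.log t / visits a (a t) t) ≤ 1 := by
      rw [Real.sqrt_le_one, div_le_one₀ (by exact_mod_cast (by omega : 0 < visits a (a t) t))]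
      have h5 : (t : ℝ) ≤ 2 * visits a (a t) t := by exact_mod_cast (by omega)
      rw [div_lt_iff₀ ht0] at h4
      linarith
    have hd : 2 < √(2 * Real.log t / visits a b t) := by
      rw [Real.lt_sqrt (by norm_num), lt_div_iff₀ (by exact_mod_cast Nat.pos_of_ne_zero hb0)]
      have h6 : (visits a b t : ℝ) < B := by exact_mod_cast hbB
      have : (0 : ℝ) ≤ B := by positivity
      linarith
    have := empMean_le_one (a t) hr (a := a) t
    have := empMean_nonneg b hr (a := a) t
    unfold realIndex at hle
    linarith
  obtain ⟨t₀, ht₀⟩ := eventually_atTop.1 key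
  have hgrow : ∀ n, n ≤ visits a b (t₀ + 1 + n) := by
    intro n
    induction n with
    | zero => exact Nat.zero_le _
    | succ n ih =>
      rw [← add_assoc, visits_succ a b (by omega), if_pos (ht₀ _ (by omega))]
      omega
  exact absurd (hB (t₀ + 1 + B)) (not_lt.2 (hgrow B))

variable {μ : Arm → ℝ}

/-- Under UCB with consistent empirical means, the suboptimal arm is pulled at most logarithmically
often. -/
theorem exists_visits_one_le_log (hμ : μ 1 < μ 0) (hr : ∀ t, 1 ≤ t → r t = 0 ∨ r t = 1)
    (hmax : ∀ t, 1 ≤ t → ∀ b, ucbIndex a r b t ≤ ucbIndex a r (a t) t)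
    (hmean : ∀ b, Tendsto (empMean a r b) atTop (𝓝 (μ b))) :
    ∃ C D : ℝ, ∀ᶠ t : ℕ in atTop, (visits a 1 t : ℝ) ≤ C * Real.log t + D := by
  have hgap : 0 < (μ 0 - μ 1) / 2 := by linarith
  have h1 := ((hmean 0).sub (hmean 1)).eventually
    (lt_mem_nhds (show (μ 0 - μ 1) / 2 < μ 0 - μ 1 by linarith))
  have h2 := (tendsto_visits 1 hr hmax).eventually_gt_atTop 0
  obtain ⟨s, hs⟩ := eventually_atTop.1 (h1.and (h2.and (eventually_ge_atTop 1)))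
  set δ := (μ 0 - μ 1) / 2
  -- From time `s` on the empirical means differ by more than `δ`, so a pull of arm `1` needs a
  -- bonus of at least `δ`, that is, at most 2 log t / δ² earlier visits. The `+ 1` counts the pull
  -- itself.
  refine ⟨2 / δ ^ 2, visits a 1 s + 1, eventually_atTop.2 ⟨s, fun t ht => ?_⟩⟩
  induction t, ht using Nat.le_induction with
  | base =>
    have : 0 ≤ 2 / δ ^ 2 * Real.log s := by positivity
    linarith
  | succ t ht ih =>
    obtain ⟨hm, hv, h1t⟩ := hs t ht
    have hlog : Real.log t ≤ Real.log (t + 1 : ℕ) :=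
      Real.log_le_log (by exact_mod_cast h1t) (by push_cast; linarith)
    have hmul : 2 / δ ^ 2 * Real.log t ≤ 2 / δ ^ 2 * Real.log (t + 1 : ℕ) := by gcongr
    rw [visits_succ a 1 h1t]
    split_ifs with h
    · have hmx := hmax t h1t 0
      rw [h] at hmx
      obtain ⟨-, hle⟩ := realIndex_le_of_ucbIndex_le hv.ne' hmx
      unfold realIndex at hle
      have hv' : (0 : ℝ) < visits a 1 t := by exact_mod_cast hv
      have hsq : δ ≤ √(2 * Real.log t / visits a 1 t) := by
        have := Real.sqrt_nonneg (2 * Real.log t / visits a 0 t)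
        linarith
      rw [Real.le_sqrt hgap.le (by positivity), le_div_iff₀ hv', mul_comm,
        ← le_div_iff₀ (by positivity)] at hsq
      have : (0 : ℝ) ≤ visits a 1 s := by positivity
      push_cast at hmul ⊢
      have e : 2 * Real.log t / δ ^ 2 = 2 / δ ^ 2 * Real.log t := by ring
      linarith
    · rw [add_zero]; linarith

theorem tendsto_visits_one_div (hμ : μ 1 < μ 0) (hr : ∀ t, 1 ≤ t → r t = 0 ∨ r t = 1)
    (hmax : ∀ t, 1 ≤ t → ∀ b, ucbIndex a r b t ≤ ucbIndex a r (a t) t)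
    (hmean : ∀ b, Tendsto (empMean a r b) atTop (𝓝 (μ b))) :
    Tendsto (fun t : ℕ => (visits a 1 t : ℝ) / t) atTop (𝓝 0) := by
  obtain ⟨C, D, h⟩ := exists_visits_one_le_log hμ hr hmax hmean
  have hlim : Tendsto (fun t : ℕ => C * (Real.log t / t) + D / t) atTop (𝓝 0) := by
    simpa using (tendsto_log_div_atTop.const_mul C).add (tendsto_const_div_atTop_nhds_zero_nat D)
  refine tendsto_of_tendsto_of_tendsto_of_le_of_le' tendsto_const_nhds hlim
    (Eventually.of_forall fun t => by positivity) ?_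
  filter_upwards [h] with t ht
  calc (visits a 1 t : ℝ) / t ≤ (C * Real.log t + D) / t := by gcongr
    _ = _ := by ring

/-- A condition on the history before time `t`: if arm `1` is pulled at time `t`, then as long as
it yields only rewards `1`, UCB keeps pulling it until time `t + T - 1`. -/
def GoodStart (a : ℕ → Arm) (r : ℕ → ℝ) (T t : ℕ) : Prop :=
  visits a 0 t ≠ 0 ∧ visits a 1 t ≠ 0 ∧ ∀ i, 0 < i → i < T →
    √(2 * Real.log (t + i : ℕ) / visits a 0 t) - √(2 * Real.log t / visits a 0 t) <
      (successes a r 1 t + i) / (visits a 1 t + i : ℕ)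
        + √(2 * Real.log (t + i : ℕ) / (visits a 1 t + i : ℕ))
        - (successes a r 1 t / visits a 1 t + √(2 * Real.log t / visits a 1 t))

theorem successful_stretch {t : ℕ} (ht : 1 ≤ t) (i : ℕ)
    (h : ∀ j < i, a (t + j) = 1 ∧ r (t + j) = 1) :
    visits a 0 (t + i) = visits a 0 t ∧ visits a 1 (t + i) = visits a 1 t + i ∧
      successes a r 0 (t + i) = successes a r 0 t ∧
      successes a r 1 (t + i) = successes a r 1 t + i := by
  induction i with
  | zero => simp
  | succ i ih =>
    obtain ⟨h1, h2, h3, h4⟩ := ih fun j hj => h j (by omega)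
    obtain ⟨h5, h6⟩ := h i (by omega)
    simp only [← add_assoc, visits_succ a _ (show 1 ≤ t + i by omega),
      successes_succ a r _ (show 1 ≤ t + i by omega), h1, h2, h3, h4, h5, h6]
    refine ⟨by simp, by simp, by simp, ?_⟩
    push_cast
    simp [add_assoc]

/-- The two sides of the inequality in `GoodStart` are the changes of the two indices between `t`
and `t + i` after `i` successes. The order of the indices at time `t` is therefore kept, and
strictly, so that ties play no role. -/
theorem GoodStart.pulls {T t : ℕ} (hg : GoodStart a r T t) (ht : 1 ≤ t)
    (hmax : ∀ t, 1 ≤ t → ∀ b, ucbIndex a r b t ≤ ucbIndex a r (a t) t) (ha : a t = 1)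
    {i : ℕ} (hi : i < T) (h : ∀ j < i, a (t + j) = 1 ∧ r (t + j) = 1) : a (t + i) = 1 := by
  obtain ⟨h0, h1, hg⟩ := hg
  rcases Nat.eq_zero_or_pos i with rfl | hpos
  · exact ha
  refine arm_eq_one_of_ne_zero fun h2 => ?_
  obtain ⟨e1, e2, e3, e4⟩ := successful_stretch ht i h
  have hm := hmax t ht 0
  rw [ha] at hm
  have hm' := hmax (t + i) (by omega) 1
  rw [h2] at hm'
  have k1 := (realIndex_le_of_ucbIndex_le h1 hm).2
  have k2 := (realIndex_le_of_ucbIndex_le (by rw [e1]; exact h0) hm').2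
  have k3 := hg i hpos hi
  unfold realIndex empMean at k1 k2
  rw [e1, e2, e3, e4] at k2
  linarith

/-- A number in [0, 1] is at most its square root; apply this to n/(n+i). The loss of bonus carries
the same factor i/(n+i) as the gain of the empirical mean, so the two can be compared. -/
theorem sqrt_div_sub_sqrt_div_le {L n i : ℝ} (hn : 0 < n) (hi : 0 ≤ i) :
    √(L / n) - √(L / (n + i)) ≤ √(L / n) * (i / (n + i)) := by
  have hx : n / (n + i) ≤ √(n / (n + i)) := by
    refine Real.le_sqrt_of_sq_le ?_
    have h1 : n / (n + i) ≤ 1 := div_le_one_of_le₀ (by linarith) (by linarith)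
    have h0 : 0 ≤ n / (n + i) := by positivity
    nlinarith
  have e1 : L / (n + i) = n / (n + i) * (L / n) := by field_simp
  have e2 : i / (n + i) = 1 - n / (n + i) := by field_simp; ring
  rw [e1, Real.sqrt_mul (by positivity), e2]
  nlinarith [Real.sqrt_nonneg (L / n)]

theorem sqrt_sub_sqrt_le {x y : ℝ} (hx : 0 ≤ x) (hxy : x ≤ y) : √y - √x ≤ √(y - x) := by
  rw [sub_le_iff_le_add, Real.sqrt_le_left (by positivity)]
  have h1 := Real.sq_sqrt hx
  have h2 := Real.sq_sqrt (sub_nonneg.2 hxy)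
  have h3 := mul_nonneg (Real.sqrt_nonneg (y - x)) (Real.sqrt_nonneg x)
  nlinarith

theorem log_add_sub_log_le {t i : ℝ} (ht : 0 < t) (hi : 0 ≤ i) :
    Real.log (t + i) - Real.log t ≤ i / t := by
  rw [← Real.log_div (by positivity) (by positivity)]
  have := Real.log_le_sub_one_of_pos (show 0 < (t + i) / t by positivity)
  have e : (t + i) / t - 1 = i / t := by field_simp; ring
  linarith

/-- Under UCB with consistent empirical means, late exploration episodes have a good start. -/
theorem eventually_goodStart (hμ : μ 1 < μ 0) (hμ₁ : μ 0 < 1)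
    (hr : ∀ t, 1 ≤ t → r t = 0 ∨ r t = 1)
    (hmax : ∀ t, 1 ≤ t → ∀ b, ucbIndex a r b t ≤ ucbIndex a r (a t) t)
    (hmean : ∀ b, Tendsto (empMean a r b) atTop (𝓝 (μ b))) (T : ℕ) :
    ∀ᶠ t : ℕ in atTop, a t = 0 → GoodStart a r T (t + 1) := by
  -- Of the room 8ε below 1, four ε are lost on the bonus and one on the mean of arm `1`, which
  -- leaves a margin of 3ε.
  set ε := (1 - μ 0) / 8 with hε
  have hε0 : 0 < ε := by linarith
  have hN := tendsto_visits_one_div hμ hr hmax hmean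
  have hT := tendsto_const_div_atTop_nhds_zero_nat (T + 1 : ℝ)
  have hi := tendsto_const_div_atTop_nhds_zero_nat (2 : ℝ)
  filter_upwards [(hmean 0).eventually (gt_mem_nhds (show μ 0 < μ 0 + ε by linarith)),
    (hmean 1).eventually (lt_mem_nhds (show μ 1 - ε < μ 1 by linarith)),
    ((hmean 1).comp (tendsto_add_atTop_nat 1)).eventually
      (gt_mem_nhds (show μ 1 < μ 1 + ε by linarith)),
    hN.eventually (gt_mem_nhds (show 0 < ε / 2 by linarith)),
    hN.eventually (gt_mem_nhds (show (0 : ℝ) < 1 / 4 by norm_num)),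
    hT.eventually (gt_mem_nhds (show 0 < ε / 2 by linarith)),
    hi.eventually (gt_mem_nhds (show 0 < ε ^ 2 by positivity)),
    tendsto_log_div_atTop.eventually (gt_mem_nhds (show 0 < ε ^ 2 / 4 by positivity)),
    (tendsto_visits 1 hr hmax).eventually_gt_atTop 0, eventually_ge_atTop 4]
    with t hm0 hm1 hm1' hn hn' hT hi hlog hv ht ha
  have ht0 : (0 : ℝ) < t := by exact_mod_cast (by omega : 0 < t)
  have ht4 : (4 : ℝ) ≤ t := by exact_mod_cast ht
  have e1 : visits a 1 (t + 1) = visits a 1 t := by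
    rw [visits_succ a 1 (by omega), ha]; simp
  have e0 : visits a 0 (t + 1) = visits a 0 t + 1 := by
    rw [visits_succ a 0 (by omega), ha]; simp
  have hsum := visits_add_visits a (t := t) (by omega)
  have hsum' : (visits a 0 t : ℝ) + visits a 1 t + 1 = t := by exact_mod_cast hsum
  rw [div_lt_iff₀ ht0] at hn hn' hT hi hlog
  have hm : (t : ℝ) / 2 ≤ visits a 0 t := by linarith
  have hv0 : visits a 0 t ≠ 0 := by
    intro h; rw [h] at hm; norm_num at hm; linarith
  have hmx := hmax t (by omega) 1
  rw [ha] at hmx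
  have hle := (realIndex_le_of_ucbIndex_le hv0 hmx).2
  unfold realIndex at hle
  have hv0' : (0 : ℝ) < visits a 0 t := by linarith
  have hv' : (1 : ℝ) ≤ visits a 1 t := by exact_mod_cast hv
  set n : ℝ := (visits a 1 t : ℝ) with hndef
  have hbon0 : √(2 * Real.log t / visits a 0 t) ≤ ε := by
    rw [Real.sqrt_le_left hε0.le, div_le_iff₀ hv0']
    nlinarith [sq_nonneg ε]
  have hlogt : 0 ≤ Real.log t := Real.log_natCast_nonneg t
  have hlogs : Real.log t ≤ Real.log (t + 1) := Real.log_le_log ht0 (by linarith)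
  have hbon1 : √(2 * Real.log (t + 1 : ℕ) / n) - √(2 * Real.log t / n) ≤ ε := by
    push_cast
    refine (sqrt_sub_sqrt_le (by positivity) (by gcongr)).trans ?_
    rw [Real.sqrt_le_left hε0.le, ← sub_div, div_le_iff₀ (by linarith)]
    have h1 := log_add_sub_log_le ht0 zero_le_one
    have h2 : 2 * (1 / (t : ℝ)) ≤ ε ^ 2 := by
      rw [mul_one_div, div_le_iff₀ ht0]; linarith
    nlinarith [sq_nonneg ε]
  -- Arm `0` was preferred at time `t`, which caps the bonus of arm `1`. The errors are one ε for
  -- each mean, one for the bonus of arm `0`, and one for passing from `t` to `t + 1`.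
  have hbeta : √(2 * Real.log (t + 1 : ℕ) / n) ≤ μ 0 - μ 1 + 4 * ε := by linarith
  refine ⟨by omega, by omega, fun i hi0 hiT => ?_⟩
  rw [e1, e0]
  push_cast
  push_cast at hbeta
  have hi1 : (1 : ℝ) ≤ i := by exact_mod_cast hi0
  have hiT' : (i : ℝ) ≤ T := by exact_mod_cast hiT.le
  have hlogi : Real.log (t + 1) ≤ Real.log (t + 1 + i) :=
    Real.log_le_log (by linarith) (by linarith)
  have hmean1 : successes a r 1 (t + 1) / n < μ 1 + ε := by
    have := hm1'
    simp only [Function.comp_def, empMean, e1] at this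
    exact this
  have hlogt1 : 0 ≤ Real.log (t + 1) := hlogt.trans hlogs
  have hlhs : √(2 * Real.log (t + 1 + i) / (visits a 0 t + 1))
      - √(2 * Real.log (t + 1) / (visits a 0 t + 1)) ≤ 2 * i / t := by
    refine (sqrt_sub_sqrt_le (by positivity) (by gcongr)).trans ?_
    rw [Real.sqrt_le_left (by positivity), ← sub_div, div_le_iff₀ (by linarith)]
    have h1 := log_add_sub_log_le (show (0 : ℝ) < t + 1 by linarith) (show (0 : ℝ) ≤ i by linarith)
    have h2 : (i : ℝ) / (t + 1) ≤ i / t := by gcongr; linarith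
    calc 2 * Real.log (t + 1 + i) - 2 * Real.log (t + 1) ≤ 2 * (i / t) := by linarith
      -- As i ≥ 1, replacing i by i² makes the bound a square times t/2, and arm `0` has at least
      -- t/2 visits.
      _ ≤ 2 * (i * i / t) := by gcongr; nlinarith
      _ = (2 * i / t) ^ 2 * (t / 2) := by field_simp
      _ ≤ (2 * i / t) ^ 2 * (visits a 0 t + 1) := by gcongr; linarith
  have hbon : √(2 * Real.log (t + 1) / n) - √(2 * Real.log (t + 1 + i) / (n + i))
      ≤ √(2 * Real.log (t + 1) / n) * (i / (n + i)) := by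
    refine le_trans ?_ (sqrt_div_sub_sqrt_div_le (by linarith) (by linarith))
    gcongr
  have hgain : (successes a r 1 (t + 1) + i) / (n + i) - successes a r 1 (t + 1) / n
      = (1 - successes a r 1 (t + 1) / n) * (i / (n + i)) := by
    have h1 : n ≠ 0 := by linarith
    have h2 : n + i ≠ 0 := by linarith
    field_simp
    ring
  -- Here the sublinear number of visits to arm `1` enters: n + i < εt.
  have hfin : 2 * i / t < 3 * ε * (i / (n + i)) := by
    rw [mul_div_assoc', div_lt_div_iff₀ ht0 (by linarith)]
    have h1 : 0 < ε * t := mul_pos hε0 ht0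
    have h2 : 2 * (n + i) < 3 * ε * t := by linarith
    calc 2 * i * (n + i) = i * (2 * (n + i)) := by ring
      _ < i * (3 * ε * t) := by gcongr
      _ = 3 * ε * i * t := by ring
  have hpos : 0 ≤ (i : ℝ) / (n + i) := by positivity
  have hkey : 3 * ε * (i / (n + i)) ≤
      (1 - successes a r 1 (t + 1) / n - √(2 * Real.log (t + 1) / n)) * (i / (n + i)) := by
    gcongr
    linarith
  linarith

end Deterministic

/-! ### Measurability with respect to the history. -/

section Measurability

variable {Ω : Type*} (A : ℕ → Ω → Arm) (R : ℕ → Ω → ℝ)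

theorem historySigma_mono {s t : ℕ} (h : s ≤ t) : historySigma A R s ≤ historySigma A R t :=
  biSup_mono fun i hi => by simp only [Finset.mem_Ico] at hi ⊢; omega

theorem measurable_arm_historySigma {i t : ℕ} (hi : 1 ≤ i) (hit : i < t) :
    Measurable[historySigma A R t] (A i) := by
  rw [measurable_iff_comap_le]
  exact le_sup_left.trans (le_iSup₂_of_le i (Finset.mem_Ico.2 ⟨hi, hit⟩) le_rfl)

theorem measurable_reward_historySigma {i t : ℕ} (hi : 1 ≤ i) (hit : i < t) :
    Measurable[historySigma A R t] (R i) := by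
  rw [measurable_iff_comap_le]
  exact le_sup_right.trans (le_iSup₂_of_le i (Finset.mem_Ico.2 ⟨hi, hit⟩) le_rfl)

/-- The σ-algebra generated by the history and the arm pulled at time `t`. -/
abbrev actionSigma (t : ℕ) : MeasurableSpace Ω :=
  historySigma A R t ⊔ MeasurableSpace.comap (A t) inferInstance

theorem measurable_arm_actionSigma (t : ℕ) : Measurable[actionSigma A R t] (A t) := by
  rw [measurable_iff_comap_le]
  exact le_sup_right

theorem actionSigma_le_historySigma_succ {t : ℕ} (ht : 1 ≤ t) :
    actionSigma A R t ≤ historySigma A R (t + 1) :=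
  sup_le (historySigma_mono A R t.le_succ)
    (measurable_iff_comap_le.1 (measurable_arm_historySigma A R ht t.lt_succ_self))

theorem measurable_visits (b : Arm) (t : ℕ) :
    Measurable[historySigma A R t] fun ω => visits (fun i => A i ω) b t := by
  have : (fun ω => visits (fun i => A i ω) b t)
      = fun ω => ∑ i ∈ Finset.Ico 1 t, if A i ω = b then 1 else 0 := by
    ext ω; simp [visits]
  rw [this]
  refine Finset.measurable_sum _ fun i hi => ?_
  rw [Finset.mem_Ico] at hi
  exact (measurable_of_countable fun x : Arm => if x = b then 1 else 0).comp
    (measurable_arm_historySigma A R hi.1 hi.2)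

theorem measurable_successes (b : Arm) (t : ℕ) :
    Measurable[historySigma A R t] fun ω => successes (fun i => A i ω) (fun i => R i ω) b t := by
  have : (fun ω => successes (fun i => A i ω) (fun i => R i ω) b t)
      = fun ω => ∑ i ∈ Finset.Ico 1 t, (if A i ω = b then 1 else 0) * R i ω := by
    ext ω; simp [successes, Finset.sum_filter]
  rw [this]
  refine Finset.measurable_sum _ fun i hi => ?_
  rw [Finset.mem_Ico] at hi
  exact ((measurable_of_countable fun x : Arm => if x = b then (1 : ℝ) else 0).comp
    (measurable_arm_historySigma A R hi.1 hi.2)).mul (measurable_reward_historySigma A R hi.1 hi.2)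

end Measurability

/-! ### The martingale of rewards weighted by inverse visit counts. -/

section WeightedNoise

variable {Ω : Type*} {μ : Arm → ℝ} {A : ℕ → Ω → Arm} {R : ℕ → Ω → ℝ}

/-- The indicator of success at time `t`, centered at its conditional probability. -/
def noise (μ : Arm → ℝ) (A : ℕ → Ω → Arm) (R : ℕ → Ω → ℝ) (t : ℕ) (ω : Ω) : ℝ :=
  (R t ⁻¹' {1}).indicator (fun _ => 1) ω - μ (A t ω)

theorem abs_noise_le (μ : Arm → ℝ) (A : ℕ → Ω → Arm) (R : ℕ → Ω → ℝ) (t : ℕ) (ω : Ω) :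
    |noise μ A R t ω| ≤ 1 + |μ 0| + |μ 1| := by
  have h1 : |(R t ⁻¹' {1}).indicator (fun _ => (1 : ℝ)) ω| ≤ 1 := by
    by_cases h : ω ∈ R t ⁻¹' {1} <;> simp [h]
  have h2 : |μ (A t ω)| ≤ |μ 0| + |μ 1| := by
    rcases eq_or_ne (A t ω) 0 with h | h
    · rw [h]; linarith [abs_nonneg (μ 1)]
    · rw [arm_eq_one_of_ne_zero h]; linarith [abs_nonneg (μ 0)]
  exact (abs_sub _ _).trans (by linarith)

theorem measurable_noise_historySigma {t s : ℕ} (ht : 1 ≤ t) (hts : t < s) :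
    Measurable[historySigma A R s] (noise μ A R t) :=
  (measurable_const.indicator
    (measurable_reward_historySigma A R ht hts (measurableSet_singleton 1))).sub
    ((measurable_of_countable μ).comp (measurable_arm_historySigma A R ht hts))

/-- The weight of time `t` in the martingale associated with arm `b`: the inverse of the number of
pulls including that at time `t`, if `b` is pulled then, and `0` otherwise. -/
def pullWeight (A : ℕ → Ω → Arm) (b : Arm) (t : ℕ) (ω : Ω) : ℝ :=
  (if A t ω = b then 1 else 0) * ((visits (fun i => A i ω) b t : ℝ) + 1)⁻¹

theorem measurable_pullWeight (A : ℕ → Ω → Arm) (R : ℕ → Ω → ℝ) (b : Arm) (t : ℕ) :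
    Measurable[actionSigma A R t] (pullWeight A b t) := by
  have hv : Measurable[actionSigma A R t] fun ω => (visits (fun i => A i ω) b t : ℝ) :=
    (measurable_of_countable (fun n : ℕ => (n : ℝ))).comp
      ((measurable_visits A R b t).mono le_sup_left le_rfl)
  exact ((measurable_of_countable fun x : Arm => if x = b then (1 : ℝ) else 0).comp
    (measurable_arm_actionSigma A R t)).mul (hv.add_const 1).inv

theorem pullWeight_nonneg (A : ℕ → Ω → Arm) (b : Arm) (t : ℕ) (ω : Ω) :
    0 ≤ pullWeight A b t ω := by
  unfold pullWeight
  split_ifs <;> positivity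

/-- The telescoping form of the bound on 1/(n+1)²: the squared weights have a sum at most 2,
whatever the policy. -/
theorem pullWeight_sq_le (A : ℕ → Ω → Arm) (b : Arm) {t : ℕ} (ht : 1 ≤ t) (ω : Ω) :
    pullWeight A b t ω ^ 2 ≤ 2 * ((visits (fun i => A i ω) b t : ℝ) + 1)⁻¹
      - 2 * ((visits (fun i => A i ω) b (t + 1) : ℝ) + 1)⁻¹ := by
  unfold pullWeight
  rw [visits_succ _ _ ht]
  split_ifs
  · push_cast
    set n : ℝ := (visits (fun i => A i ω) b t : ℝ)
    have hn : 0 ≤ n := Nat.cast_nonneg _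
    have : 2 * (n + 1)⁻¹ - 2 * (n + 1 + 1)⁻¹ - (1 * (n + 1)⁻¹) ^ 2
        = n / ((n + 1) ^ 2 * (n + 1 + 1)) := by
      field_simp
      ring
    have : 0 ≤ n / ((n + 1) ^ 2 * (n + 1 + 1)) := by positivity
    linarith
  · simp

theorem abs_pullWeight_le (A : ℕ → Ω → Arm) (b : Arm) (t : ℕ) (ω : Ω) :
    |pullWeight A b t ω| ≤ 1 := by
  rw [abs_of_nonneg (pullWeight_nonneg A b t ω)]
  unfold pullWeight
  have : ((visits (fun i => A i ω) b t : ℝ) + 1)⁻¹ ≤ 1 :=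
    inv_le_one_of_one_le₀ (by linarith [Nat.cast_nonneg (α := ℝ) (visits (fun i => A i ω) b t)])
  split_ifs
  · linarith
  · simp

/-- The martingale `∑_{1 ≤ i ≤ n, A_i = b} (1{R_i = 1} - μ_b) / N_b(i + 1)`. -/
def weightedNoise (μ : Arm → ℝ) (A : ℕ → Ω → Arm) (R : ℕ → Ω → ℝ) (b : Arm) (n : ℕ) (ω : Ω) : ℝ :=
  ∑ i ∈ Finset.range n, pullWeight A b (i + 1) ω * noise μ A R (i + 1) ω

theorem measurable_weightedNoise (b : Arm) (n : ℕ) :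
    Measurable[historySigma A R (n + 1)] (weightedNoise μ A R b n) := by
  refine Finset.measurable_sum _ fun i hi => ?_
  rw [Finset.mem_range] at hi
  exact ((measurable_pullWeight A R b (i + 1)).mono
      ((actionSigma_le_historySigma_succ A R (by omega)).trans (historySigma_mono A R (by omega)))
      le_rfl).mul (measurable_noise_historySigma (by omega) (by omega))

theorem abs_weightedNoise_le (b : Arm) (n : ℕ) (ω : Ω) :
    |weightedNoise μ A R b n ω| ≤ n * (1 + |μ 0| + |μ 1|) := by
  refine (Finset.abs_sum_le_sum_abs _ _).trans ?_
  rw [← Finset.card_range n, ← nsmul_eq_mul, Finset.card_range]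
  refine (Finset.sum_le_card_nsmul _ _ (1 + |μ 0| + |μ 1|) fun i _ => ?_).trans (by simp)
  rw [abs_mul]
  exact (mul_le_mul (abs_pullWeight_le A b _ ω) (abs_noise_le μ A R _ ω) (abs_nonneg _)
    zero_le_one).trans (by simp)

end WeightedNoise

/-! ### Strong law of large numbers under adaptive sampling. -/

section LawOfLargeNumbers

variable {Ω : Type*} [mΩ : MeasurableSpace Ω] {P : Measure Ω} {μ : Arm → ℝ}
  {A : ℕ → Ω → Arm} {R : ℕ → Ω → ℝ}

theorem IsBernoulliBanditRun.historySigma_le (h : IsBernoulliBanditRun P μ A R) (t : ℕ) :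
    historySigma A R t ≤ mΩ :=
  iSup₂_le fun i hi => sup_le
    (measurable_iff_comap_le.1 (h.measurable_arm i (Finset.mem_Ico.1 hi).1))
    (measurable_iff_comap_le.1 (h.measurable_reward i (Finset.mem_Ico.1 hi).1))

theorem IsBernoulliBanditRun.actionSigma_le (h : IsBernoulliBanditRun P μ A R) {t : ℕ}
    (ht : 1 ≤ t) : actionSigma A R t ≤ mΩ :=
  (actionSigma_le_historySigma_succ A R ht).trans (h.historySigma_le _)

theorem IsBernoulliBanditRun.integrable_mul_noise [IsProbabilityMeasure P]
    (h : IsBernoulliBanditRun P μ A R) {t : ℕ} (ht : 1 ≤ t) {g : Ω → ℝ} (hg : Measurable g)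
    {c : ℝ} (hc : ∀ ω, |g ω| ≤ c) : Integrable (fun ω => g ω * noise μ A R t ω) P := by
  refine Integrable.of_bound (C := c * (1 + |μ 0| + |μ 1|)) (hg.mul
    ((measurable_noise_historySigma ht t.lt_succ_self).mono (h.historySigma_le _)
      le_rfl)).aestronglyMeasurable (Eventually.of_forall fun ω => ?_)
  rw [Real.norm_eq_abs, abs_mul]
  exact mul_le_mul (hc ω) (abs_noise_le μ A R t ω) (abs_nonneg _)
    ((abs_nonneg _).trans (hc ω))

/-- The factor `g` pulls out, and the noise is centred given history and action. The action must be
included because a randomized choice of arm is not a function of the history. -/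
theorem IsBernoulliBanditRun.condExp_mul_noise [IsProbabilityMeasure P]
    (h : IsBernoulliBanditRun P μ A R) {t : ℕ} (ht : 1 ≤ t) {g : Ω → ℝ}
    (hg : Measurable[actionSigma A R t] g) {c : ℝ} (hc : ∀ ω, |g ω| ≤ c) :
    P[fun ω => g ω * noise μ A R t ω | actionSigma A R t] =ᵐ[P] 0 := by
  have hle := h.actionSigma_le ht
  have hi1 : Integrable (noise μ A R t) P := by
    simpa using h.integrable_mul_noise ht (g := fun _ => 1) measurable_const (c := 1) (by simp)
  have hi2 : Integrable ((R t ⁻¹' {1}).indicator fun _ => (1 : ℝ)) P :=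
    (integrable_const 1).indicator (h.measurable_reward t ht (measurableSet_singleton 1))
  have hmeas : Measurable[actionSigma A R t] fun ω => μ (A t ω) :=
    (measurable_of_countable μ).comp (measurable_arm_actionSigma A R t)
  have hi3 : Integrable (fun ω => μ (A t ω)) P := by
    have := hi2.sub hi1
    refine this.congr (Eventually.of_forall fun ω => ?_)
    simp [noise]
  have hsub : P[noise μ A R t | actionSigma A R t] =ᵐ[P] 0 := by
    have h1 := condExp_sub hi2 hi3 (actionSigma A R t)
    have h2 := h.reward_law t ht
    have h3 := condExp_of_stronglyMeasurable hle hmeas.stronglyMeasurable hi3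
    refine EventuallyEq.trans h1 ?_
    filter_upwards [h2] with ω h2
    simp only [Pi.sub_apply, Pi.zero_apply, h3]
    rw [sub_eq_zero]
    exact h2
  have := condExp_mul_of_stronglyMeasurable_left hg.stronglyMeasurable
    (h.integrable_mul_noise ht (hg.mono hle le_rfl) hc) hi1
  refine EventuallyEq.trans this ?_
  filter_upwards [hsub] with ω hω
  simp [hω]

theorem IsBernoulliBanditRun.integral_mul_noise [IsProbabilityMeasure P]
    (h : IsBernoulliBanditRun P μ A R) {t : ℕ} (ht : 1 ≤ t) {g : Ω → ℝ}
    (hg : Measurable[actionSigma A R t] g) {c : ℝ} (hc : ∀ ω, |g ω| ≤ c) :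
    ∫ ω, g ω * noise μ A R t ω ∂P = 0 := by
  rw [← integral_condExp (h.actionSigma_le ht), integral_congr_ae (h.condExp_mul_noise ht hg hc)]
  simp

/-- The filtration of histories. -/
def IsBernoulliBanditRun.filtration (h : IsBernoulliBanditRun P μ A R) : Filtration ℕ mΩ where
  seq n := historySigma A R (n + 1)
  mono' _ _ hmn := historySigma_mono A R (by omega)
  le' n := h.historySigma_le (n + 1)

theorem IsBernoulliBanditRun.integrable_weightedNoise [IsProbabilityMeasure P]
    (h : IsBernoulliBanditRun P μ A R) (b : Arm) (n : ℕ) :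
    Integrable (weightedNoise μ A R b n) P :=
  Integrable.of_bound (C := n * (1 + |μ 0| + |μ 1|)) ((measurable_weightedNoise b n).mono
    (h.historySigma_le _) le_rfl).aestronglyMeasurable
    (Eventually.of_forall fun ω => abs_weightedNoise_le b n ω)

theorem IsBernoulliBanditRun.martingale_weightedNoise [IsProbabilityMeasure P]
    (h : IsBernoulliBanditRun P μ A R) (b : Arm) :
    Martingale (weightedNoise μ A R b) h.filtration P := by
  refine martingale_of_condExp_sub_eq_zero_nat
    (fun n => (measurable_weightedNoise b n).stronglyMeasurable)
    (fun n => h.integrable_weightedNoise b n) fun n => ?_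
  have e : weightedNoise μ A R b (n + 1) - weightedNoise μ A R b n
      = fun ω => pullWeight A b (n + 1) ω * noise μ A R (n + 1) ω := by
    ext ω
    simp [weightedNoise, Finset.sum_range_succ]
  rw [e]
  have h1 := h.condExp_mul_noise (t := n + 1) (by omega) (measurable_pullWeight A R b (n + 1))
    (abs_pullWeight_le A b (n + 1))
  -- Tower property: condition on the action first, then on the history alone.
  have h2 : P[P[fun ω => pullWeight A b (n + 1) ω * noise μ A R (n + 1) ω |
      actionSigma A R (n + 1)] | historySigma A R (n + 1)] =ᵐ[P]
      P[fun ω => pullWeight A b (n + 1) ω * noise μ A R (n + 1) ω | historySigma A R (n + 1)] :=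
    condExp_condExp_of_le le_sup_left (h.actionSigma_le (by omega))
  refine h2.symm.trans ((condExp_congr_ae h1).trans ?_)
  rw [condExp_zero]

/-- The potential `V` pays for the squared increments by `pullWeight_sq_le`, and the cross terms
have mean zero. So the expectation of M² + V never increases from its initial value 2c². -/
theorem IsBernoulliBanditRun.integral_weightedNoise_sq_le [IsProbabilityMeasure P]
    (h : IsBernoulliBanditRun P μ A R) (b : Arm) (n : ℕ) :
    ∫ ω, weightedNoise μ A R b n ω ^ 2 ∂P ≤ 2 * (1 + |μ 0| + |μ 1|) ^ 2 := by
  set c := 1 + |μ 0| + |μ 1| with hc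
  have hc0 : 0 ≤ c := by positivity
  let V : ℕ → Ω → ℝ := fun n ω => 2 * c ^ 2 * ((visits (fun i => A i ω) b (n + 1) : ℝ) + 1)⁻¹
  have hV0 : ∀ n ω, 0 ≤ V n ω := fun n ω => by positivity
  have hMm : ∀ n, Measurable (weightedNoise μ A R b n) := fun n =>
    (measurable_weightedNoise b n).mono (h.historySigma_le _) le_rfl
  have hM2 : ∀ n, Integrable (fun ω => weightedNoise μ A R b n ω ^ 2) P := fun n => by
    refine Integrable.of_bound (C := (n * c) ^ 2) ((hMm n).pow_const 2).aestronglyMeasurable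
      (Eventually.of_forall fun ω => ?_)
    rw [Real.norm_eq_abs, abs_pow]
    exact pow_le_pow_left₀ (abs_nonneg _) (abs_weightedNoise_le b n ω) 2
  have hV : ∀ n, Integrable (V n) P := fun n => by
    have hv : Measurable fun ω => (visits (fun i => A i ω) b (n + 1) : ℝ) :=
      (measurable_of_countable (fun n : ℕ => (n : ℝ))).comp
        ((measurable_visits A R b (n + 1)).mono (h.historySigma_le _) le_rfl)
    refine Integrable.of_bound (C := 2 * c ^ 2)
      ((hv.add_const 1).inv.const_mul _).aestronglyMeasurable (Eventually.of_forall fun ω => ?_)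
    rw [Real.norm_of_nonneg (hV0 n ω)]
    refine mul_le_of_le_one_right (by positivity) (inv_le_one_of_one_le₀ ?_)
    linarith [Nat.cast_nonneg (α := ℝ) (visits (fun i => A i ω) b (n + 1))]
  suffices hs : ∫ ω, (weightedNoise μ A R b n ω ^ 2 + V n ω) ∂P ≤ 2 * c ^ 2 by
    refine (integral_mono (hM2 n) ((hM2 n).add (hV n)) fun ω => ?_).trans hs
    simpa using hV0 n ω
  induction n with
  | zero => simp [weightedNoise, V, visits_one]
  | succ n ih =>
    have hg : Measurable[actionSigma A R (n + 1)]
        fun ω => 2 * weightedNoise μ A R b n ω * pullWeight A b (n + 1) ω :=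
      (((measurable_weightedNoise b n).mono le_sup_left le_rfl).const_mul 2).mul
        (measurable_pullWeight A R b (n + 1))
    have hgb : ∀ ω, |2 * weightedNoise μ A R b n ω * pullWeight A b (n + 1) ω|
        ≤ 2 * (n * c) := fun ω => by
      rw [abs_mul, abs_mul, abs_two]
      exact (mul_le_of_le_one_right (by positivity) (abs_pullWeight_le A b _ ω)).trans
        (mul_le_mul_of_nonneg_left (abs_weightedNoise_le b n ω) zero_le_two)
    have hzero := h.integral_mul_noise (by omega) hg hgb
    have hint := h.integrable_mul_noise (t := n + 1) (by omega)
      (hg.mono (h.actionSigma_le (by omega)) le_rfl) hgb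
    calc ∫ ω, (weightedNoise μ A R b (n + 1) ω ^ 2 + V (n + 1) ω) ∂P
        ≤ ∫ ω, ((weightedNoise μ A R b n ω ^ 2 + V n ω) +
          2 * weightedNoise μ A R b n ω * pullWeight A b (n + 1) ω * noise μ A R (n + 1) ω) ∂P := by
          refine integral_mono ((hM2 _).add (hV _)) (((hM2 _).add (hV _)).add hint) fun ω => ?_
          have hw := pullWeight_sq_le A b (t := n + 1) (by omega) ω
          have hη : noise μ A R (n + 1) ω ^ 2 ≤ c ^ 2 := by
            rw [← sq_abs]
            exact pow_le_pow_left₀ (abs_nonneg _) (abs_noise_le μ A R _ ω) 2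
          have hmul : pullWeight A b (n + 1) ω ^ 2 * noise μ A R (n + 1) ω ^ 2
              ≤ V n ω - V (n + 1) ω :=
            calc _ ≤ _ * c ^ 2 := mul_le_mul hw hη (sq_nonneg _) ((sq_nonneg _).trans hw)
              _ = V n ω - V (n + 1) ω := by simp only [V]; ring
          have e : weightedNoise μ A R b (n + 1) ω = weightedNoise μ A R b n ω
              + pullWeight A b (n + 1) ω * noise μ A R (n + 1) ω := by
            simp [weightedNoise, Finset.sum_range_succ]
          simp only [e]
          linarith
      _ = ∫ ω, (weightedNoise μ A R b n ω ^ 2 + V n ω) ∂P := by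
          have := integral_add ((hM2 n).add (hV n)) hint
          rw [hzero, add_zero] at this
          exact this
      _ ≤ 2 * c ^ 2 := ih

/-- Since |x| ≤ 1 + x², the L² bound gives the L¹ bound needed for martingale convergence. -/
theorem IsBernoulliBanditRun.ae_exists_tendsto_weightedNoise [IsProbabilityMeasure P]
    (h : IsBernoulliBanditRun P μ A R) (b : Arm) :
    ∀ᵐ ω ∂P, ∃ l, Tendsto (fun n => weightedNoise μ A R b n ω) atTop (𝓝 l) := by
  refine (h.martingale_weightedNoise b).submartingale.exists_ae_tendsto_of_bdd
    (R := (1 + 2 * (1 + |μ 0| + |μ 1|) ^ 2).toNNReal) fun n => ?_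
  have hi := h.integrable_weightedNoise b n
  have hi2 : Integrable (fun ω => weightedNoise μ A R b n ω ^ 2) P := by
    refine Integrable.of_bound (C := (n * (1 + |μ 0| + |μ 1|)) ^ 2)
      (hi.aestronglyMeasurable.pow 2) (Eventually.of_forall fun ω => ?_)
    rw [Real.norm_eq_abs, abs_pow]
    exact pow_le_pow_left₀ (abs_nonneg _) (abs_weightedNoise_le b n ω) 2
  rw [eLpNorm_one_eq_lintegral_enorm, ← ofReal_integral_norm_eq_lintegral_enorm hi]
  refine ENNReal.ofReal_le_ofReal ?_
  calc ∫ ω, ‖weightedNoise μ A R b n ω‖ ∂P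
      ≤ ∫ ω, (1 + weightedNoise μ A R b n ω ^ 2) ∂P := by
        refine integral_mono hi.norm ((integrable_const 1).add hi2) fun ω => ?_
        rw [Real.norm_eq_abs]
        simp only
        rw [← sq_abs]
        nlinarith [sq_nonneg (|weightedNoise μ A R b n ω| - 1)]
    _ = 1 + ∫ ω, weightedNoise μ A R b n ω ^ 2 ∂P := by
        rw [integral_add (integrable_const 1) hi2]; simp
    _ ≤ _ := by
        have := h.integral_weightedNoise_sq_le b n
        linarith

/-- Kronecker's lemma. -/
theorem tendsto_sum_mul_sub_div {M g : ℕ → ℝ} {l : ℝ} (hM : Tendsto M atTop (𝓝 l)) (hg : 0 ≤ g)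
    (hG : Tendsto (fun n => ∑ i ∈ Finset.range n, g i) atTop atTop) :
    Tendsto (fun n => (∑ i ∈ Finset.range n,
      (∑ j ∈ Finset.range (i + 1), g j) * (M (i + 1) - M i)) / ∑ i ∈ Finset.range n, g i)
      atTop (𝓝 0) := by
  set G : ℕ → ℝ := fun n => ∑ i ∈ Finset.range n, g i with hGdef
  -- Summation by parts: after division by `G n` there remain `M n - l` and a `g`-weighted average
  -- of the `M i - l`, both tending to 0.
  have habel : ∀ n, ∑ i ∈ Finset.range n, G (i + 1) * (M (i + 1) - M i)
      = G n * (M n - l) - ∑ i ∈ Finset.range n, (M i - l) * g i := by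
    intro n
    induction n with
    | zero => simp [hGdef]
    | succ n ih =>
      have e : G (n + 1) = G n + g n := Finset.sum_range_succ _ _
      rw [Finset.sum_range_succ, Finset.sum_range_succ, ih, e]
      ring
  have h0 : Tendsto (fun n => M n - l) atTop (𝓝 0) := by simpa using hM.sub_const l
  have hlo : (fun n => (M n - l) * g n) =o[atTop] g := by
    simpa using (Asymptotics.isLittleO_one_iff ℝ).2 h0 |>.mul_isBigO (Asymptotics.isBigO_refl g _)
  have hsum := (hlo.sum_range hg hG).tendsto_div_nhds_zero
  have hdiff := h0.sub hsum
  rw [sub_zero] at hdiff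
  refine hdiff.congr' ?_
  filter_upwards [hG.eventually_gt_atTop 0] with n hn
  have hn' : G n ≠ 0 := ne_of_gt hn
  change _ = (∑ i ∈ Finset.range n, G (i + 1) * (M (i + 1) - M i)) / G n
  rw [habel, sub_div, mul_div_cancel_left₀ _ hn']

/-- Strong law of large numbers for the rewards of an arm, under adaptive sampling. -/
theorem IsBernoulliBanditRun.ae_tendsto_empMean [IsProbabilityMeasure P]
    (h : IsBernoulliBanditRun P μ A R) (b : Arm) :
    ∀ᵐ ω ∂P, Tendsto (visits (fun i => A i ω) b) atTop atTop →
      Tendsto (empMean (fun i => A i ω) (fun i => R i ω) b) atTop (𝓝 (μ b)) := by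
  have hr : ∀ᵐ ω ∂P, ∀ t, 1 ≤ t → R t ω = 0 ∨ R t ω = 1 :=
    ae_all_iff.2 fun t => eventually_imp_distrib_left.2 (h.reward_zero_or_one t)
  filter_upwards [h.ae_exists_tendsto_weightedNoise b, hr] with ω ⟨l, hl⟩ hr hv
  set a : ℕ → Arm := fun i => A i ω with ha
  set g : ℕ → ℝ := fun i => if a (i + 1) = b then 1 else 0 with hg
  have hG : ∀ n, ∑ i ∈ Finset.range n, g i = visits a b (n + 1) := by
    intro n
    induction n with
    | zero => simp [visits_one]
    | succ n ih =>
      rw [Finset.sum_range_succ, ih, visits_succ a b (show 1 ≤ n + 1 by omega)]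
      simp [hg]
  -- At each pull of `b` the partial sum of `g` is the inverse of the weight, so Kronecker's sum is
  -- the centred sum of rewards.
  have hS : ∀ n, ∑ i ∈ Finset.range n, (∑ j ∈ Finset.range (i + 1), g j) *
      (weightedNoise μ A R b (i + 1) ω - weightedNoise μ A R b i ω)
      = successes a (fun i => R i ω) b (n + 1) - μ b * visits a b (n + 1) := by
    intro n
    induction n with
    | zero => simp [visits_one, successes]
    | succ n ih =>
      rw [Finset.sum_range_succ, ih, hG, visits_succ a b (show 1 ≤ n + 1 by omega),
        successes_succ a _ b (show 1 ≤ n + 1 by omega)]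
      have e : weightedNoise μ A R b (n + 1) ω - weightedNoise μ A R b n ω
          = pullWeight A b (n + 1) ω * noise μ A R (n + 1) ω := by
        simp [weightedNoise, Finset.sum_range_succ]
      rw [e]
      unfold pullWeight noise
      by_cases hb : a (n + 1) = b
      · have hb' : A (n + 1) ω = b := hb
        -- The noise is built from the indicator of success, which is the reward itself only because
        -- rewards are `0` or `1`.
        have hind : (R (n + 1) ⁻¹' {1}).indicator (fun _ => (1 : ℝ)) ω = R (n + 1) ω := by
          rcases hr (n + 1) (by omega) with h0 | h0 <;> simp [Set.indicator, h0]
        have hne : (visits a b (n + 1) : ℝ) + 1 ≠ 0 := by positivity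
        rw [hind, if_pos hb, if_pos hb', if_pos hb, hb']
        push_cast
        field_simp
        ring
      · have hb' : ¬ A (n + 1) ω = b := hb
        simp [hb, hb']
  have hv' : Tendsto (fun n => ∑ i ∈ Finset.range n, g i) atTop atTop := by
    simp_rw [hG]
    exact tendsto_natCast_atTop_atTop.comp (hv.comp (tendsto_add_atTop_nat 1))
  have hk := tendsto_sum_mul_sub_div hl (g := g)
    (fun i => by simp only [hg]; split_ifs <;> simp) hv'
  simp_rw [hS, hG] at hk
  rw [← tendsto_add_atTop_iff_nat 1]
  have hk' := hk.add_const (μ b)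
  rw [zero_add] at hk'
  refine hk'.congr' ?_
  filter_upwards [(hv.comp (tendsto_add_atTop_nat 1)).eventually_gt_atTop 0] with n hn
  have hne : (visits a b (n + 1) : ℝ) ≠ 0 := by exact_mod_cast (ne_of_gt hn)
  unfold empMean
  field_simp
  ring

end LawOfLargeNumbers

/-! ### Combinatorics of exploration episodes. -/

section Episodes

theorem iInf_natCast_eq_coe_iff {p : ℕ → Prop} {n : ℕ} :
    (⨅ (t : ℕ) (_ : p t), (t : ℕ∞)) = n ↔ p n ∧ ∀ m, p m → n ≤ m := by
  classical
  constructor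
  · intro h
    have hle : ∀ m, p m → n ≤ m := fun m hm => by
      have : (n : ℕ∞) ≤ m := h ▸ iInf₂_le m hm
      exact_mod_cast this
    refine ⟨?_, hle⟩
    by_contra hn
    have h1 : ((n + 1 : ℕ) : ℕ∞) ≤ ⨅ (t : ℕ) (_ : p t), (t : ℕ∞) := by
      refine le_iInf₂ fun m hm => ?_
      have h2 := hle m hm
      have h3 : n ≠ m := fun e => hn (e ▸ hm)
      exact_mod_cast (by omega : n + 1 ≤ m)
    rw [h] at h1
    have : n + 1 ≤ n := by exact_mod_cast h1
    omega
  · rintro ⟨h1, h2⟩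
    exact le_antisymm (iInf₂_le n h1) (le_iInf₂ fun m hm => by exact_mod_cast h2 m hm)

variable {a : ℕ → Arm}

theorem explorationTime_zero_eq_iff {t : ℕ} :
    explorationTime a 0 = t ↔ (1 ≤ t ∧ a t = 1) ∧ ∀ m, 1 ≤ m ∧ a m = 1 → t ≤ m :=
  iInf_natCast_eq_coe_iff

theorem explorationTime_succ_eq_iff {k t : ℕ} :
    explorationTime a (k + 1) = t ↔
      (explorationTime a k < t ∧ a t = 1 ∧ a (t - 1) = 0) ∧
        ∀ m : ℕ, explorationTime a k < m ∧ a m = 1 ∧ a (m - 1) = 0 → t ≤ m :=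
  iInf_natCast_eq_coe_iff

theorem one_le_of_explorationTime_eq {k t : ℕ} (h : explorationTime a k = t) :
    1 ≤ t ∧ a t = 1 := by
  cases k with
  | zero => exact (explorationTime_zero_eq_iff.1 h).1
  | succ k =>
    obtain ⟨⟨h1, h2, -⟩, -⟩ := explorationTime_succ_eq_iff.1 h
    refine ⟨Nat.one_le_iff_ne_zero.2 ?_, h2⟩
    rintro rfl
    simp at h1

/-- This form only involves times up to `t`, so that measurability of the episode times can be read
off by induction. -/
theorem explorationTime_succ_eq_iff_exists {k t : ℕ} :
    explorationTime a (k + 1) = t ↔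
      ∃ s ∈ Finset.Ico 1 t, explorationTime a k = s ∧ a t = 1 ∧ a (t - 1) = 0 ∧
        ∀ m ∈ Finset.Ioo s t, ¬(a m = 1 ∧ a (m - 1) = 0) := by
  rw [explorationTime_succ_eq_iff]
  constructor
  · rintro ⟨⟨h1, h2, h3⟩, h4⟩
    obtain ⟨s, hs⟩ := ENat.ne_top_iff_exists.1 h1.ne_top
    rw [← hs] at h1 h4
    have hst : s < t := by exact_mod_cast h1
    refine ⟨s, Finset.mem_Ico.2 ⟨(one_le_of_explorationTime_eq hs.symm).1, hst⟩, hs.symm, h2, h3,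
      fun m hm hcon => ?_⟩
    rw [Finset.mem_Ioo] at hm
    have := h4 m ⟨by exact_mod_cast hm.1, hcon⟩
    omega
  · rintro ⟨s, hs, h1, h2, h3, h4⟩
    rw [Finset.mem_Ico] at hs
    rw [h1]
    refine ⟨⟨by exact_mod_cast hs.2, h2, h3⟩, fun m ⟨hm, hm'⟩ => ?_⟩
    by_contra hlt
    exact h4 m (Finset.mem_Ioo.2 ⟨by exact_mod_cast hm, by omega⟩) hm'

theorem explorationTime_lt_of_lt {j k t : ℕ} (hjk : j < k) (h : explorationTime a k = t) :
    ∃ s < t, explorationTime a j = s := by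
  induction k generalizing t with
  | zero => omega
  | succ k ih =>
    obtain ⟨s, hs, h1, -⟩ := explorationTime_succ_eq_iff_exists.1 h
    have hst := (Finset.mem_Ico.1 hs).2
    rcases Nat.lt_succ_iff_lt_or_eq.1 hjk with hlt | rfl
    · obtain ⟨u, hu, h2⟩ := ih hlt h1
      exact ⟨u, hu.trans hst, h2⟩
    · exact ⟨s, hst, h1⟩

/-- If an episode is interrupted at or before time `s + i`, then it is so before the start of any
later episode. -/
theorem exists_interruption_lt {j k s t i : ℕ} (hjk : j < k) (hs : explorationTime a j = s)
    (ht : explorationTime a k = t) (hi : a (s + i) = 0) :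
    ∃ i' ≤ i, s + i' < t ∧ a (s + i') = 0 := by
  classical
  have hex : ∃ i, a (s + i) = 0 := ⟨i, hi⟩
  refine ⟨Nat.find hex, Nat.find_min' hex hi, ?_, Nat.find_spec hex⟩
  obtain ⟨u, hu, hut⟩ : ∃ u ≤ t, explorationTime a (j + 1) = u := by
    rcases Nat.lt_or_eq_of_le (Nat.succ_le_of_lt hjk) with h | h
    · obtain ⟨u, hu, h'⟩ := explorationTime_lt_of_lt h ht
      exact ⟨u, hu.le, h'⟩
    · exact ⟨t, le_rfl, by rw [← ht, ← h]⟩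
  obtain ⟨⟨h1, -, h2⟩, -⟩ := explorationTime_succ_eq_iff.1 hut
  rw [hs] at h1
  have hsu : s < u := by exact_mod_cast h1
  -- The next episode starts at `u ≤ t`, just after a pull of arm `0` at time `u - 1`, so the first
  -- interruption is no later than that.
  have : Nat.find hex ≤ u - 1 - s := Nat.find_min' hex (by
    rw [show s + (u - 1 - s) = u - 1 by omega]; exact h2)
  omega

/-- If both arms are pulled infinitely often, there are infinitely many exploration episodes. -/
theorem exists_strictMono_explorationTime (h : ∀ b, ∃ᶠ t in atTop, a t = b) :
    ∃ f : ℕ → ℕ, StrictMono f ∧ (∀ k, explorationTime a k = f k) ∧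
      ∀ k, a (f (k + 1) - 1) = 0 := by
  classical
  have hfin : ∀ k, ∃ t : ℕ, explorationTime a k = t := by
    intro k
    induction k with
    | zero =>
      obtain ⟨t, ht, hat⟩ := frequently_atTop.1 (h 1) 1
      have hex : ∃ t, 1 ≤ t ∧ a t = 1 := ⟨t, ht, hat⟩
      exact ⟨Nat.find hex, explorationTime_zero_eq_iff.2
        ⟨Nat.find_spec hex, fun m hm => Nat.find_min' hex hm⟩⟩
    | succ k ih =>
      obtain ⟨s, hs⟩ := ih
      obtain ⟨u, hu, hau⟩ := frequently_atTop.1 (h 0) (s + 1)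
      -- The first pull of arm `1` after `u` directly follows a pull of arm `0`.
      have hex1 : ∃ v, u < v ∧ a v = 1 := by
        obtain ⟨v, hv, hav⟩ := frequently_atTop.1 (h 1) (u + 1)
        exact ⟨v, hv, hav⟩
      have hv := Nat.find_spec hex1
      have hv0 : a (Nat.find hex1 - 1) = 0 := by
        by_contra hne
        rcases Nat.lt_or_eq_of_le (show u ≤ Nat.find hex1 - 1 by omega) with hlt | heq
        · exact Nat.find_min hex1 (m := Nat.find hex1 - 1) (by omega)
            ⟨hlt, arm_eq_one_of_ne_zero hne⟩
        · rw [← heq] at hne; exact hne hau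
      have hex2 : ∃ t : ℕ, explorationTime a k < t ∧ a t = 1 ∧ a (t - 1) = 0 :=
        ⟨Nat.find hex1, by rw [hs]; exact_mod_cast (by omega : s < Nat.find hex1), hv.2, hv0⟩
      exact ⟨Nat.find hex2, explorationTime_succ_eq_iff.2
        ⟨Nat.find_spec hex2, fun m hm => Nat.find_min' hex2 hm⟩⟩
  choose f hf using hfin
  refine ⟨f, strictMono_nat_of_lt_succ fun k => ?_, hf, fun k =>
    (explorationTime_succ_eq_iff.1 (hf (k + 1))).1.2.2⟩
  have := (explorationTime_succ_eq_iff.1 (hf (k + 1))).1.1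
  rw [hf k] at this
  exact_mod_cast this

theorem frequently_eq_of_tendsto_visits {b : Arm} (h : Tendsto (visits a b) atTop atTop) :
    ∃ᶠ t in atTop, a t = b := by
  intro hcon
  obtain ⟨t₀, ht₀⟩ := eventually_atTop.1 hcon
  have hconst : ∀ n, visits a b (t₀ + 1 + n) = visits a b (t₀ + 1) := by
    intro n
    induction n with
    | zero => rfl
    | succ n ih =>
      rw [← add_assoc, visits_succ a b (by omega), if_neg (ht₀ _ (by omega)), ih, add_zero]
  obtain ⟨t, ht, ht'⟩ :=
    ((h.eventually_gt_atTop (visits a b (t₀ + 1))).and (eventually_ge_atTop (t₀ + 1))).exists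
  have := hconst (t - (t₀ + 1))
  rw [show t₀ + 1 + (t - (t₀ + 1)) = t by omega] at this
  omega

end Episodes

/-! ### Episode starts as stopping times. -/

section EpisodeMeasurability

variable {Ω : Type*} (A : ℕ → Ω → Arm) (R : ℕ → Ω → ℝ)

/-- An episode starting at `t` is recognized from the arm pulled at `t`, so the history before `t`
alone would not do. -/
theorem measurableSet_episode_eq (k t : ℕ) :
    MeasurableSet[actionSigma A R t] {ω | episode A k ω = t} := by
  have hact : ∀ {s : ℕ}, 1 ≤ s → s ≤ t → ∀ b, MeasurableSet[actionSigma A R t] (A s ⁻¹' {b}) := by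
    intro s hs hst b
    rcases Nat.lt_or_eq_of_le hst with h | rfl
    · exact le_sup_left (a := historySigma A R t) _
        (measurable_arm_historySigma A R hs h (measurableSet_singleton b))
    · exact measurable_arm_actionSigma A R s (measurableSet_singleton b)
  induction k generalizing t with
  | zero =>
    have e : {ω | episode A 0 ω = t} =
        {ω | 1 ≤ t} ∩ (A t ⁻¹' {1} ∩ ⋂ m ∈ Finset.Ico 1 t, (A m ⁻¹' {1})ᶜ) := by
      ext ω
      simp only [episode, Set.mem_ofPred_eq, explorationTime_zero_eq_iff, Set.mem_inter_iff,
        Set.mem_preimage, Set.mem_singleton_iff, Set.mem_iInter, Set.mem_compl_iff, Finset.mem_Ico,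
        and_assoc]
      refine and_congr_right fun _ => and_congr_right fun _ => forall_congr' fun m => ?_
      constructor
      · intro h1 h2 h3
        have := h1 ⟨h2.1, h3⟩
        omega
      · intro h1 h2
        by_contra h3
        exact h1 ⟨h2.1, by omega⟩ h2.2
    rw [e]
    by_cases ht : 1 ≤ t
    · refine MeasurableSet.inter (MeasurableSet.const _) ((hact ht le_rfl 1).inter
        (Finset.measurableSet_biInter _ fun m hm => ?_))
      rw [Finset.mem_Ico] at hm
      exact (hact hm.1 hm.2.le 1).compl
    · simp [ht]
  | succ k ih =>
    have e : {ω | episode A (k + 1) ω = t} = ⋃ s ∈ Finset.Ico 1 t, ({ω | episode A k ω = s} ∩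
        (A t ⁻¹' {1} ∩ (A (t - 1) ⁻¹' {0} ∩
          ⋂ m ∈ Finset.Ioo s t, (A m ⁻¹' {1} ∩ A (m - 1) ⁻¹' {0})ᶜ))) := by
      ext ω
      simp only [episode, Set.mem_ofPred_eq, explorationTime_succ_eq_iff_exists, Set.mem_iUnion,
        Set.mem_inter_iff, Set.mem_preimage, Set.mem_singleton_iff, Set.mem_iInter,
        Set.mem_compl_iff, exists_prop]
    rw [e]
    refine Finset.measurableSet_biUnion _ fun s hs => ?_
    rw [Finset.mem_Ico] at hs
    have hle : actionSigma A R s ≤ actionSigma A R t :=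
      ((actionSigma_le_historySigma_succ A R hs.1).trans (historySigma_mono A R hs.2)).trans
        le_sup_left
    refine (hle _ (ih s fun hs1 hst b => ?_)).inter ((hact (by omega) le_rfl 1).inter
      ((hact (by omega) (by omega) 0).inter (Finset.measurableSet_biInter _ fun m hm => ?_)))
    · rcases Nat.lt_or_eq_of_le hst with h | rfl
      · exact le_sup_left (a := historySigma A R s) _
          (measurable_arm_historySigma A R hs1 h (measurableSet_singleton b))
      · exact measurable_arm_actionSigma A R _ (measurableSet_singleton b)
    · rw [Finset.mem_Ioo] at hm
      exact ((hact (by omega) (by omega) 1).inter (hact (by omega) (by omega) 0)).compl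

theorem measurableSet_goodStart (T t : ℕ) :
    MeasurableSet[historySigma A R t] {ω | GoodStart (fun i => A i ω) (fun i => R i ω) T t} := by
  have hv := fun b => measurable_visits A R b t
  have hs := measurable_successes A R 1 t
  have hvf : ∀ (b : Arm) (f : ℕ → ℝ), Measurable[historySigma A R t]
      fun ω => f (visits (fun i => A i ω) b t) := fun b f =>
    (measurable_of_countable f).comp (hv b)
  have e : {ω | GoodStart (fun i => A i ω) (fun i => R i ω) T t} =
      {ω | visits (fun i => A i ω) 0 t ∈ ({0} : Set ℕ)ᶜ} ∩
        ({ω | visits (fun i => A i ω) 1 t ∈ ({0} : Set ℕ)ᶜ} ∩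
        ⋂ i : ℕ, ⋂ _ : 0 < i, ⋂ _ : i < T, {ω |
          √(2 * Real.log (t + i : ℕ) / visits (fun i => A i ω) 0 t)
            - √(2 * Real.log t / visits (fun i => A i ω) 0 t) <
          (successes (fun i => A i ω) (fun i => R i ω) 1 t + i)
            / (visits (fun i => A i ω) 1 t + i : ℕ)
          + √(2 * Real.log (t + i : ℕ) / (visits (fun i => A i ω) 1 t + i : ℕ))
          - (successes (fun i => A i ω) (fun i => R i ω) 1 t / visits (fun i => A i ω) 1 t
            + √(2 * Real.log t / visits (fun i => A i ω) 1 t))}) := by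
    ext ω
    simp [GoodStart]
  rw [e]
  refine (hv 0 (measurableSet_singleton 0).compl).inter
    ((hv 1 (measurableSet_singleton 0).compl).inter (MeasurableSet.iInter fun i =>
      MeasurableSet.iInter fun _ => MeasurableSet.iInter fun _ => measurableSet_lt ?_ ?_))
  · exact hvf 0 fun n => √(2 * Real.log (t + i : ℕ) / n) - √(2 * Real.log t / n)
  · exact (((hs.add_const _).div (hvf 1 fun n => ((n + i : ℕ) : ℝ))).add
      (hvf 1 fun n => √(2 * Real.log (t + i : ℕ) / (n + i : ℕ)))).sub
      ((hs.div (hvf 1 fun n => (n : ℝ))).add (hvf 1 fun n => √(2 * Real.log t / n)))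

/-- The event that the history before time `t` guarantees a long episode if its rewards are `1`. -/
def goodStartEvent (A : ℕ → Ω → Arm) (R : ℕ → Ω → ℝ) (T t : ℕ) : Set Ω :=
  {ω | GoodStart (fun i => A i ω) (fun i => R i ω) T t}

theorem eventAt_inter_eventAt (E U : ℕ → Set Ω) (σ : Ω → ℕ∞) :
    eventAt E σ ∩ eventAt U σ = ⋃ t : ℕ, {ω | σ ω = t} ∩ (E t ∩ U t) := by
  ext ω
  simp only [eventAt, Set.mem_inter_iff, Set.mem_ofPred_eq, Set.mem_iUnion]
  constructor
  · rintro ⟨⟨t, h1, h2⟩, s, h3, h4⟩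
    have : t = s := by exact_mod_cast h1.symm.trans h3
    subst this
    exact ⟨t, h1, h2, h4⟩
  · rintro ⟨t, h1, h2, h3⟩
    exact ⟨⟨t, h1, h2⟩, t, h1, h3⟩

theorem measurableSet_episode_eq_inter (T k t : ℕ) {U : ℕ → Set Ω}
    (hU : ∀ t, 1 ≤ t → MeasurableSet[historySigma A R t] (U t)) (ht : 1 ≤ t) :
    MeasurableSet[actionSigma A R t]
      ({ω | episode A k ω = t} ∩ (goodStartEvent A R T t ∩ U t)) :=
  (measurableSet_episode_eq A R k t).inter
    (le_sup_left (a := historySigma A R t) _ ((measurableSet_goodStart A R T t).inter (hU t ht)))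

end EpisodeMeasurability

/-! ### Probability of a long stretch of arm `1`. -/

section Stretches

theorem hasSum_measureReal_iUnion {α : Type*} [MeasurableSpace α] {P : Measure α}
    [IsFiniteMeasure P] {f : ℕ → Set α} (hm : ∀ i, MeasurableSet (f i))
    (hd : Pairwise (Function.onFun Disjoint f)) :
    HasSum (fun i => P.real (f i)) (P.real (⋃ i, f i)) := by
  have h1 := measure_iUnion (μ := P) hd hm
  have h2 : ∑' i, P (f i) ≠ ⊤ := h1 ▸ measure_ne_top P _
  have h3 := ENNReal.hasSum_toReal h2
  rwa [← ENNReal.tsum_toReal_eq fun i => measure_ne_top P _, ← h1] at h3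

variable {Ω : Type*} [mΩ : MeasurableSpace Ω] {P : Measure Ω}
  {μ : Arm → ℝ} {A : ℕ → Ω → Arm} {R : ℕ → Ω → ℝ}

theorem IsBernoulliBanditRun.measureReal_inter_reward [IsProbabilityMeasure P]
    (h : IsBernoulliBanditRun P μ A R) {t : ℕ}
    (ht : 1 ≤ t) {S : Set Ω} (hS : MeasurableSet[actionSigma A R t] S) {b : Arm}
    (hb : ∀ ω ∈ S, A t ω = b) : P.real (S ∩ R t ⁻¹' {1}) = μ b * P.real S := by
  have hle := h.actionSigma_le ht
  have hR : MeasurableSet (R t ⁻¹' {1}) := h.measurable_reward t ht (measurableSet_singleton 1)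
  have h1 : ∫ ω in S, (R t ⁻¹' {1}).indicator (fun _ => (1 : ℝ)) ω ∂P
      = P.real (S ∩ R t ⁻¹' {1}) := by
    rw [setIntegral_indicator hR]
    simp
  rw [← h1, ← setIntegral_condExp hle ((integrable_const 1).indicator hR) hS]
  have h2 : ∫ ω in S, (P⟦R t ⁻¹' {1} | actionSigma A R t⟧) ω ∂P = ∫ _ in S, μ b ∂P := by
    refine setIntegral_congr_ae (hle _ hS) ?_
    filter_upwards [h.reward_law t ht] with ω hω hmem
    rw [← hb ω hmem]
    exact hω
  rw [h2]
  simp [mul_comm]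

theorem measurableSet_badStretch (h : IsBernoulliBanditRun P μ A R) (T : ℕ) {t : ℕ} (ht : 1 ≤ t) :
    MeasurableSet (badStretch A T t) := by
  have e : badStretch A T t = ⋂ i ∈ Finset.range T, A (t + i) ⁻¹' {1} := by
    ext ω; simp [badStretch]
  rw [e]
  exact Finset.measurableSet_biInter _ fun i _ =>
    h.measurable_arm _ (by omega) (measurableSet_singleton 1)

theorem IsUCBRun.ae_picks_max (h : IsUCBRun P μ A R) : ∀ᵐ ω ∂P, ∀ t, 1 ≤ t → ∀ b,
    ucbIndex (fun i => A i ω) (fun i => R i ω) b t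
      ≤ ucbIndex (fun i => A i ω) (fun i => R i ω) (A t ω) t :=
  ae_all_iff.2 fun t => eventually_imp_distrib_left.2 (h.picks_max t)

/-- On `W i` the first `i` pulls all hit arm `1` and succeed. The good start then forces the next
pull to be arm `1` almost surely, and its reward is `1` with conditional probability `μ 1`, so each
step costs one factor `μ 1`. -/
theorem IsUCBRun.pow_mul_measureReal_le [IsProbabilityMeasure P]
    (h : IsUCBRun P μ A R) (hμ : 0 ≤ μ 1) (T : ℕ) {t : ℕ}
    (ht : 1 ≤ t) {V : Set Ω} (hV : MeasurableSet[actionSigma A R t] V)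
    (hV1 : ∀ ω ∈ V, A t ω = 1)
    (hVg : ∀ ω ∈ V, GoodStart (fun i => A i ω) (fun i => R i ω) T t) :
    μ 1 ^ T * P.real V ≤ P.real (V ∩ badStretch A T t) := by
  let W : ℕ → Set Ω := fun i => V ∩ {ω | ∀ j < i, A (t + j) ω = 1 ∧ R (t + j) ω = 1}
  have hWsucc : ∀ i, W (i + 1) = (W i ∩ A (t + i) ⁻¹' {1}) ∩ R (t + i) ⁻¹' {1} := by
    intro i
    ext ω
    simp only [W, Set.mem_inter_iff, Set.mem_ofPred_eq, Set.mem_preimage, Set.mem_singleton_iff,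
      Nat.lt_succ_iff_lt_or_eq, or_imp, forall_and, forall_eq]
    tauto
  have hWm : ∀ i, MeasurableSet[actionSigma A R (t + i)] (W i) := by
    intro i
    induction i with
    | zero => simpa [W] using hV
    | succ i ih =>
      have hle := actionSigma_le_historySigma_succ A R (show 1 ≤ t + i by omega)
      rw [hWsucc]
      exact le_sup_left (a := historySigma A R (t + (i + 1))) _ (((hle _ ih).inter
        (measurable_arm_historySigma A R (by omega) (by omega) (measurableSet_singleton 1))).inter
        (measurable_reward_historySigma A R (by omega) (by omega) (measurableSet_singleton 1)))
  have hmain : ∀ i ≤ T, μ 1 ^ i * P.real V ≤ P.real (W i) := by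
    intro i
    induction i with
    | zero => simp [W]
    | succ i ih =>
      intro hi
      have hae : P.real (W i ∩ A (t + i) ⁻¹' {1}) = P.real (W i) := by
        refine measureReal_congr ?_
        filter_upwards [h.ae_picks_max] with ω hω
        refine propext ⟨fun hmem => hmem.1, fun hmem => ⟨hmem, ?_⟩⟩
        exact (hVg ω hmem.1).pulls ht hω (hV1 ω hmem.1) hi hmem.2
      rw [hWsucc, h.measureReal_inter_reward (by omega) ((hWm i).inter
        (measurable_arm_actionSigma A R _ (measurableSet_singleton 1))) (fun ω hω => hω.2), hae,
        pow_succ', mul_assoc]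
      exact mul_le_mul_of_nonneg_left (ih (by omega)) hμ
  refine (hmain T le_rfl).trans (measureReal_mono ?_)
  exact fun ω hω => ⟨hω.1, fun j hj => (hω.2 j hj).1⟩

theorem IsUCBRun.measurableSet_eventAt_inter (h : IsUCBRun P μ A R) (T k : ℕ) {U : ℕ → Set Ω}
    (hU : ∀ t, 1 ≤ t → MeasurableSet[historySigma A R t] (U t)) :
    MeasurableSet (eventAt (goodStartEvent A R T) (episode A k) ∩ eventAt U (episode A k)) := by
  rw [eventAt_inter_eventAt]
  refine MeasurableSet.iUnion fun t => ?_
  by_cases ht : 1 ≤ t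
  · exact h.actionSigma_le ht _ (measurableSet_episode_eq_inter A R T k t hU ht)
  · have e : {ω | episode A k ω = t} = ∅ := Set.eq_empty_of_forall_notMem fun ω hω =>
      ht (one_le_of_explorationTime_eq hω).1
    rw [e, Set.empty_inter]
    exact MeasurableSet.empty

/-- Sum the bound at a fixed time over the disjoint possible values of the starting time. -/
theorem IsUCBRun.pow_mul_measureReal_eventAt_le [IsProbabilityMeasure P]
    (h : IsUCBRun P μ A R) (hμ : 0 ≤ μ 1) (T k : ℕ)
    {U : ℕ → Set Ω} (hU : ∀ t, 1 ≤ t → MeasurableSet[historySigma A R t] (U t)) :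
    μ 1 ^ T * P.real (eventAt (goodStartEvent A R T) (episode A k) ∩ eventAt U (episode A k)) ≤
      P.real ((eventAt (goodStartEvent A R T) (episode A k) ∩ eventAt U (episode A k)) ∩
        eventAt (badStretch A T) (episode A k)) := by
  set D : ℕ → Set Ω := fun t => {ω | episode A k ω = t} ∩ (goodStartEvent A R T t ∩ U t) with hD
  have hDempty : ∀ t, ¬ 1 ≤ t → D t = ∅ := fun t ht =>
    Set.eq_empty_of_forall_notMem fun ω hω => ht (one_le_of_explorationTime_eq hω.1).1
  have hDm : ∀ t, MeasurableSet (D t) := fun t => by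
    by_cases ht : 1 ≤ t
    · exact h.actionSigma_le ht _ (measurableSet_episode_eq_inter A R T k t hU ht)
    · rw [hDempty t ht]; exact MeasurableSet.empty
  have hBm : ∀ t, MeasurableSet (D t ∩ badStretch A T t) := fun t => by
    by_cases ht : 1 ≤ t
    · exact (hDm t).inter (measurableSet_badStretch h.toIsBernoulliBanditRun T ht)
    · rw [hDempty t ht, Set.empty_inter]; exact MeasurableSet.empty
  have hdisj : Pairwise (Function.onFun Disjoint D) := fun s t hst =>
    Set.disjoint_left.2 fun ω h1 h2 => hst (by exact_mod_cast h1.1.symm.trans h2.1)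
  have hdisj' : Pairwise (Function.onFun Disjoint fun t => D t ∩ badStretch A T t) :=
    fun s t hst => (hdisj hst).mono Set.inter_subset_left Set.inter_subset_left
  have e1 : eventAt (goodStartEvent A R T) (episode A k) ∩ eventAt U (episode A k) = ⋃ t, D t :=
    eventAt_inter_eventAt _ _ _
  have e2 : (⋃ t, D t) ∩ eventAt (badStretch A T) (episode A k)
      = ⋃ t, D t ∩ badStretch A T t := by
    ext ω
    simp only [eventAt, Set.mem_inter_iff, Set.mem_ofPred_eq, Set.mem_iUnion]
    constructor
    · rintro ⟨⟨t, h1⟩, s, h3, h4⟩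
      have : t = s := by exact_mod_cast h1.1.symm.trans h3
      subst this
      exact ⟨t, h1, h4⟩
    · rintro ⟨t, h1, h2⟩
      exact ⟨⟨t, h1⟩, t, h1.1, h2⟩
  rw [e1, e2]
  have hs1 := (hasSum_measureReal_iUnion (P := P) hDm hdisj)
  have hs2 := (hasSum_measureReal_iUnion (P := P) hBm hdisj')
  refine hasSum_le (fun t => ?_) (hs1.mul_left (μ 1 ^ T)) hs2
  by_cases ht : 1 ≤ t
  · exact h.pow_mul_measureReal_le hμ T ht (measurableSet_episode_eq_inter A R T k t hU ht)
      (fun ω hω => (one_le_of_explorationTime_eq hω.1).2) fun ω hω => hω.2.1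
  · simp [hDempty t ht]

end Stretches

/-! ### Sliding regret of a sequence of arms. -/

section SlidingRegret

variable {μ : Arm → ℝ}

theorem sum_means_le (hμ : μ 1 ≤ μ 0) (a : ℕ → Arm) (T t : ℕ) :
    ∑ i ∈ Finset.Icc 1 T, μ (a (t + i)) ≤ T * μ 0 := by
  refine (Finset.sum_le_card_nsmul _ _ (μ 0) fun i _ => ?_).trans (by simp)
  rcases eq_or_ne (a (t + i)) 0 with h | h
  · rw [h]
  · rwa [arm_eq_one_of_ne_zero h]

theorem le_sum_means (hμ : μ 1 ≤ μ 0) (a : ℕ → Arm) (T t : ℕ) :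
    T * μ 1 ≤ ∑ i ∈ Finset.Icc 1 T, μ (a (t + i)) := by
  refine le_trans (by simp) (Finset.card_nsmul_le_sum _ _ (μ 1) fun i _ => ?_)
  rcases eq_or_ne (a (t + i)) 0 with h | h
  · rwa [h]
  · rw [arm_eq_one_of_ne_zero h]

theorem slidingRegret_le (hμ : μ 1 ≤ μ 0) (a : ℕ → Arm) (T : ℕ) :
    slidingRegret μ a T ≤ T * (μ 0 - μ 1) := by
  have hopt : optMean μ = μ 0 := max_eq_left hμ
  unfold slidingRegret
  rw [hopt]
  refine limsup_le_of_le ?_ (Eventually.of_forall fun t => ?_)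
  · refine IsBoundedUnder.isCoboundedUnder_le (isBoundedUnder_of ⟨0, fun t => ?_⟩)
    exact sub_nonneg.2 (sum_means_le hμ a T t)
  · have := le_sum_means hμ a T t
    linarith

theorem slidingRegret_eq_of_frequently (hμ : μ 1 ≤ μ 0) (a : ℕ → Arm) (T : ℕ)
    (h : ∃ᶠ t in atTop, ∀ i < T, a (t + i) = 1) :
    slidingRegret μ a T = T * (μ 0 - μ 1) := by
  refine le_antisymm (slidingRegret_le hμ a T) ?_
  have hopt : optMean μ = μ 0 := max_eq_left hμ
  unfold slidingRegret
  rw [hopt]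
  refine le_limsup_of_frequently_le ?_ (isBoundedUnder_of ⟨T * (μ 0 - μ 1), fun t => ?_⟩)
  · rw [frequently_atTop] at h ⊢
    intro N
    -- The regret window at `t - 1` covers the times `t, …, t + T - 1`; asking for `N + 1` keeps `t
    -- - 1 ≥ N`.
    obtain ⟨t, ht, hat⟩ := h (N + 1)
    refine ⟨t - 1, by omega, ?_⟩
    have e : ∑ i ∈ Finset.Icc 1 T, μ (a (t - 1 + i)) = T * μ 1 := by
      rw [Finset.sum_congr rfl (g := fun _ => μ 1) fun i hi => ?_]
      · simp
      · rw [Finset.mem_Icc] at hi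
        rw [show t - 1 + i = t + (i - 1) by omega, hat _ (by omega)]
    rw [e]
    linarith
  · have := le_sum_means hμ a T t
    linarith

end SlidingRegret

/-! ### Runs of interrupted episodes. -/

section InterruptedEpisodes

variable {Ω : Type*} {A : ℕ → Ω → Arm} {R : ℕ → Ω → ℝ}

/-- The event that each of the episodes `K, …, K + n - 1` has a good start but is interrupted
before `T` pulls. -/
def interruptedEpisodes (A : ℕ → Ω → Arm) (R : ℕ → Ω → ℝ) (T K n : ℕ) : Set Ω :=
  {ω | ∀ j, K ≤ j → j < K + n → ω ∈ eventAt (goodStartEvent A R T) (episode A j) ∧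
    ω ∉ eventAt (badStretch A T) (episode A j)}

/-- The event `interruptedEpisodes` as seen from time `t`. -/
def interruptedBefore (A : ℕ → Ω → Arm) (R : ℕ → Ω → ℝ) (T K n t : ℕ) : Set Ω :=
  ⋂ j ∈ Finset.Ico K (K + n), ⋃ s ∈ Finset.Ico 1 t,
    ({ω | episode A j ω = s} ∩ goodStartEvent A R T s) ∩
      ⋃ i ∈ (Finset.range T).filter (fun i => s + i < t), A (s + i) ⁻¹' {0}

theorem measurableSet_interruptedBefore (T K n t : ℕ) :
    MeasurableSet[historySigma A R t] (interruptedBefore A R T K n t) := by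
  refine Finset.measurableSet_biInter _ fun j _ => Finset.measurableSet_biUnion _ fun s hs => ?_
  rw [Finset.mem_Ico] at hs
  have hle : actionSigma A R s ≤ historySigma A R t :=
    (actionSigma_le_historySigma_succ A R hs.1).trans (historySigma_mono A R hs.2)
  refine (MeasurableSet.inter (hle _ (measurableSet_episode_eq A R j s))
    (historySigma_mono A R hs.2.le _ (measurableSet_goodStart A R T s))).inter
    (Finset.measurableSet_biUnion _ fun i hi => ?_)
  rw [Finset.mem_filter] at hi
  exact measurable_arm_historySigma A R (by omega) hi.2 (measurableSet_singleton 0)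

theorem eventAt_interruptedBefore_subset (T K n k : ℕ) :
    eventAt (interruptedBefore A R T K n) (episode A k) ⊆ interruptedEpisodes A R T K n := by
  rintro ω ⟨t, -, ht⟩ j hj hjn
  simp only [interruptedBefore, Set.mem_iInter, Set.mem_iUnion] at ht
  obtain ⟨s, -, ⟨hs, hg⟩, hi⟩ := ht j (Finset.mem_Ico.2 ⟨hj, hjn⟩)
  simp only [Set.mem_iUnion] at hi
  obtain ⟨i, hi, hi0⟩ := hi
  rw [Finset.mem_filter, Finset.mem_range] at hi
  refine ⟨⟨s, hs, hg⟩, ?_⟩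
  rintro ⟨s', hs', hb⟩
  have : s = s' := by exact_mod_cast hs.symm.trans hs'
  subst this
  have h1 := hb i hi.1
  rw [Set.mem_preimage, Set.mem_singleton_iff] at hi0
  rw [hi0] at h1
  exact absurd h1 (by decide)

/-- The interruption of an earlier episode occurs before the next one starts. When episode `K + n`
begins it is thus part of the history, and may serve as the past event `U`. -/
theorem interruptedEpisodes_inter_subset (T K n : ℕ) :
    interruptedEpisodes A R T K n ∩ eventAt (goodStartEvent A R T) (episode A (K + n)) ⊆
      eventAt (interruptedBefore A R T K n) (episode A (K + n)) := by
  rintro ω ⟨hω, t, ht, -⟩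
  refine ⟨t, ht, ?_⟩
  simp only [interruptedBefore, Set.mem_iInter, Set.mem_iUnion]
  intro j hj
  rw [Finset.mem_Ico] at hj
  obtain ⟨⟨s, hs, hg⟩, hb⟩ := hω j hj.1 hj.2
  have hbad : ∃ i < T, A (s + i) ω = 0 := by
    by_contra! hcon
    exact hb ⟨s, hs, fun i hi => arm_eq_one_of_ne_zero (hcon i hi)⟩
  obtain ⟨i, hi, hi0⟩ := hbad
  obtain ⟨i', hi', hlt, h0⟩ := exists_interruption_lt hj.2 hs ht hi0
  refine ⟨s, Finset.mem_Ico.2 ⟨(one_le_of_explorationTime_eq hs).1, by omega⟩, ⟨hs, hg⟩, ?_⟩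
  simp only [Set.mem_iUnion]
  exact ⟨i', Finset.mem_filter.2 ⟨Finset.mem_range.2 (by omega), hlt⟩, h0⟩

theorem interruptedEpisodes_succ (T K n : ℕ) :
    interruptedEpisodes A R T K (n + 1) = (interruptedEpisodes A R T K n ∩
      eventAt (goodStartEvent A R T) (episode A (K + n))) \
        eventAt (badStretch A T) (episode A (K + n)) := by
  ext ω
  constructor
  · intro h
    have := h (K + n) (by omega) (by omega)
    exact ⟨⟨fun j h1 h2 => h j h1 (by omega), this.1⟩, this.2⟩
  · rintro ⟨⟨h1, h2⟩, h3⟩ j hj hjn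
    rcases Nat.lt_or_ge j (K + n) with hlt | hge
    · exact h1 j hj hlt
    · obtain rfl : j = K + n := by omega
      exact ⟨h2, h3⟩

end InterruptedEpisodes

/-! ### Infinitely many long episodes. -/

section Main

variable {Ω : Type*} [mΩ : MeasurableSpace Ω] {P : Measure Ω}
  {μ : Arm → ℝ} {A : ℕ → Ω → Arm} {R : ℕ → Ω → ℝ}

/-- Under UCB there are almost surely infinitely many episodes, and all late ones start well. -/
theorem IsUCBRun.ae_episode [IsProbabilityMeasure P]
    (h : IsUCBRun P μ A R) (hμ : μ 1 < μ 0) (hμ₁ : μ 0 < 1) (T : ℕ) :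
    ∀ᵐ ω ∂P, ∃ f : ℕ → ℕ, StrictMono f ∧ (∀ k, episode A k ω = f k) ∧
      ∀ᶠ k in atTop, ω ∈ goodStartEvent A R T (f k) := by
  have hr : ∀ᵐ ω ∂P, ∀ t, 1 ≤ t → R t ω = 0 ∨ R t ω = 1 :=
    ae_all_iff.2 fun t => eventually_imp_distrib_left.2 (h.reward_zero_or_one t)
  have hmean := ae_all_iff.2 fun b => h.toIsBernoulliBanditRun.ae_tendsto_empMean b
  filter_upwards [hr, h.ae_picks_max, hmean] with ω hr hmax hmean
  have hv := fun b => tendsto_visits (a := fun i => A i ω) (r := fun i => R i ω) b hr hmax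
  obtain ⟨f, hf, hfe, hf0⟩ := exists_strictMono_explorationTime fun b =>
    frequently_eq_of_tendsto_visits (hv b)
  refine ⟨f, hf, hfe, ?_⟩
  have hgood := eventually_goodStart hμ hμ₁ hr hmax (fun b => hmean b (hv b)) T
  obtain ⟨N, hN⟩ := eventually_atTop.1 hgood
  -- Episode `0` need not follow a pull of arm `0`, so only indices `j + 1` are treated.
  refine eventually_atTop.2 ⟨N + 2, fun k hk => ?_⟩
  obtain ⟨j, rfl⟩ : ∃ j, k = j + 1 := ⟨k - 1, by omega⟩
  have hle := hf.id_le (j + 1)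
  simp only [id] at hle
  have hg := hN (f (j + 1) - 1) (by omega) (hf0 j)
  rwa [show f (j + 1) - 1 + 1 = f (j + 1) by omega] at hg

theorem IsUCBRun.ae_eventually_eventAt [IsProbabilityMeasure P]
    (h : IsUCBRun P μ A R) (hμ : μ 1 < μ 0) (hμ₁ : μ 0 < 1)
    (T : ℕ) :
    ∀ᵐ ω ∂P, ∀ᶠ k in atTop, ω ∈ eventAt (goodStartEvent A R T) (episode A k) := by
  filter_upwards [h.ae_episode hμ hμ₁ T] with ω ⟨f, _, hfe, hg⟩
  filter_upwards [hg] with k hk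
  exact ⟨f k, hfe k, hk⟩

theorem IsUCBRun.pow_le_cond_real [IsProbabilityMeasure P]
    (h : IsUCBRun P μ A R) (hμ : 0 ≤ μ 1) (T k : ℕ)
    {U : ℕ → Set Ω} (hU : ∀ t, 1 ≤ t → MeasurableSet[historySigma A R t] (U t))
    (hne : P (eventAt (goodStartEvent A R T) (episode A k) ∩ eventAt U (episode A k)) ≠ 0) :
    μ 1 ^ T ≤ (P[|eventAt (goodStartEvent A R T) (episode A k) ∩
      eventAt U (episode A k)]).real (eventAt (badStretch A T) (episode A k)) := by
  have hm := h.measurableSet_eventAt_inter T k hU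
  rw [measureReal_def, cond_apply hm, ENNReal.toReal_mul, ENNReal.toReal_inv,
    ← div_eq_inv_mul, le_div_iff₀]
  · exact h.pow_mul_measureReal_eventAt_le hμ T k hU
  · exact ENNReal.toReal_pos hne (measure_ne_top _ _)

theorem measurableSet_eventAt_badStretch (h : IsBernoulliBanditRun P μ A R) (T k : ℕ) :
    MeasurableSet (eventAt (badStretch A T) (episode A k)) := by
  have e : eventAt (badStretch A T) (episode A k)
      = ⋃ t : ℕ, {ω | episode A k ω = t} ∩ badStretch A T t := by
    ext ω; simp [eventAt]
  rw [e]
  refine MeasurableSet.iUnion fun t => ?_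
  by_cases ht : 1 ≤ t
  · exact (h.actionSigma_le ht _ (measurableSet_episode_eq A R k t)).inter
      (measurableSet_badStretch h T ht)
  · have e' : {ω | episode A k ω = t} = ∅ := Set.eq_empty_of_forall_notMem fun ω hω =>
      ht (one_le_of_explorationTime_eq hω).1
    rw [e', Set.empty_inter]
    exact MeasurableSet.empty

/-- Episodes are not independent. The bound uniform over past events replaces independence: given
that the previous episodes were interrupted, a good start is still interrupted with probability at
most `1 - μ 1 ^ T`. -/
theorem IsUCBRun.measureReal_interruptedEpisodes_le [IsProbabilityMeasure P]
    (h : IsUCBRun P μ A R) (hμ : 0 ≤ μ 1)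
    (hμ₁ : μ 1 ≤ 1) (T K n : ℕ) :
    P.real (interruptedEpisodes A R T K n) ≤ (1 - μ 1 ^ T) ^ n := by
  have hq : 0 ≤ 1 - μ 1 ^ T := sub_nonneg.2 (pow_le_one₀ hμ hμ₁)
  induction n with
  | zero => simp [measureReal_le_one]
  | succ n ih =>
    set D := eventAt (goodStartEvent A R T) (episode A (K + n)) ∩
      eventAt (interruptedBefore A R T K n) (episode A (K + n)) with hD
    set G := eventAt (badStretch A T) (episode A (K + n)) with hG
    have hsub : interruptedEpisodes A R T K (n + 1) ⊆ D \ G := by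
      rw [interruptedEpisodes_succ]
      exact Set.sdiff_subset_sdiff_left fun ω hω =>
        ⟨hω.2, interruptedEpisodes_inter_subset T K n hω⟩
    have hle := h.pow_mul_measureReal_eventAt_le hμ T (K + n) (U := interruptedBefore A R T K n)
      fun t _ => measurableSet_interruptedBefore T K n t
    have hDle : P.real D ≤ P.real (interruptedEpisodes A R T K n) :=
      measureReal_mono (Set.inter_subset_right.trans (eventAt_interruptedBefore_subset T K n _))
    have hsplit := measureReal_inter_add_sdiff (μ := P) (s := D)
      (measurableSet_eventAt_badStretch h.toIsBernoulliBanditRun T (K + n))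
    calc P.real (interruptedEpisodes A R T K (n + 1)) ≤ P.real (D \ G) := measureReal_mono hsub
      _ ≤ (1 - μ 1 ^ T) * P.real D := by linarith
      _ ≤ (1 - μ 1 ^ T) * (1 - μ 1 ^ T) ^ n := mul_le_mul_of_nonneg_left (hDle.trans ih) hq
      _ = (1 - μ 1 ^ T) ^ (n + 1) := (pow_succ' _ _).symm

/-- Otherwise, from some `K` on, every episode would start well and be interrupted, an event of
probability at most `(1 - μ 1 ^ T) ^ n` for every `n`. -/
theorem IsUCBRun.ae_frequently_badStretch [IsProbabilityMeasure P]
    (h : IsUCBRun P μ A R) (hμ₂ : 0 < μ 1)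
    (hμ : μ 1 < μ 0) (hμ₁ : μ 0 < 1) (T : ℕ) :
    ∀ᵐ ω ∂P, ∃ᶠ k in atTop, ω ∈ eventAt (badStretch A T) (episode A k) := by
  have hnull : ∀ K, P (⋂ n, interruptedEpisodes A R T K n) = 0 := by
    intro K
    have hle : ∀ n, P.real (⋂ n, interruptedEpisodes A R T K n) ≤ (1 - μ 1 ^ T) ^ n := fun n =>
      (measureReal_mono (Set.iInter_subset _ n)).trans
        (h.measureReal_interruptedEpisodes_le hμ₂.le (hμ.trans hμ₁).le T K n)
    have hlim : Tendsto (fun n : ℕ => (1 - μ 1 ^ T) ^ n) atTop (𝓝 0) :=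
      tendsto_pow_atTop_nhds_zero_of_lt_one
        (sub_nonneg.2 (pow_le_one₀ hμ₂.le (hμ.trans hμ₁).le)) (by linarith [pow_pos hμ₂ T])
    exact (measureReal_eq_zero_iff).1
      (le_antisymm (ge_of_tendsto' hlim hle) measureReal_nonneg)
  have hae : ∀ᵐ ω ∂P, ∀ K, ω ∉ ⋂ n, interruptedEpisodes A R T K n :=
    ae_all_iff.2 fun K => measure_eq_zero_iff_ae_notMem.1 (hnull K)
  filter_upwards [hae, h.ae_eventually_eventAt hμ hμ₁ T] with ω hω hE hcon
  obtain ⟨K, hK⟩ := eventually_atTop.1 (hE.and hcon)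
  exact hω K (Set.mem_iInter.2 fun n j hj _ => hK j hj)

theorem IsUCBRun.ae_slidingRegret_eq [IsProbabilityMeasure P]
    (h : IsUCBRun P μ A R) (hμ₂ : 0 < μ 1)
    (hμ : μ 1 < μ 0) (hμ₁ : μ 0 < 1) (T : ℕ) :
    ∀ᵐ ω ∂P, slidingRegret μ (fun t => A t ω) T = T * (μ 0 - μ 1) := by
  filter_upwards [h.ae_frequently_badStretch hμ₂ hμ hμ₁ T, h.ae_episode hμ hμ₁ T]
    with ω hfreq ⟨f, hf, hfe, _⟩
  refine slidingRegret_eq_of_frequently hμ.le _ T (hf.tendsto_atTop.frequently (hfreq.mono ?_))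
  rintro k ⟨t, ht, hb⟩
  have : f k = t := by exact_mod_cast (hfe k).symm.trans ht
  rw [this]
  exact hb

end Main

end Bandit

end

theorem mainTheorem4 {Ω : Type*} [MeasurableSpace Ω] (P : Measure Ω) [IsProbabilityMeasure P]
    (μ : Bandit.Arm → ℝ) (hμ₂ : 0 < μ 1) (hμ : μ 1 < μ 0) (hμ₁ : μ 0 < 1)
    (A : ℕ → Ω → Bandit.Arm) (R : ℕ → Ω → ℝ) (hrun : Bandit.IsUCBRun P μ A R) (T : ℕ) :
    -- the sliding regret of UCB is almost surely `T (μ₁ - μ₂)`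
    (∀ᵐ ω ∂P, Bandit.slidingRegret μ (fun t => A t ω) T = T * (μ 0 - μ 1)) ∧
    -- which is the worst value that any sequence of arms can have
    (∀ a : ℕ → Bandit.Arm, Bandit.slidingRegret μ a T ≤ T * (μ 0 - μ 1)) ∧
    -- at exploration episodes, on events that hold eventually and whatever the past, arm `2` is
    -- pulled `T` times in a row with conditional probability at least `μ₂ ^ T`
    (∃ E : ℕ → Set Ω,
      (∀ t, 1 ≤ t → MeasurableSet[Bandit.historySigma A R t] (E t)) ∧
      (∀ᵐ ω ∂P, ∀ᶠ k in atTop, ω ∈ Bandit.eventAt E (Bandit.episode A k)) ∧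
      ∀ U : ℕ → Set Ω, (∀ t, 1 ≤ t → MeasurableSet[Bandit.historySigma A R t] (U t)) →
        ∀ k : ℕ,
          P (Bandit.eventAt E (Bandit.episode A k) ∩ Bandit.eventAt U (Bandit.episode A k)) ≠ 0 →
          μ 1 ^ T ≤
            (P[|Bandit.eventAt E (Bandit.episode A k) ∩
                Bandit.eventAt U (Bandit.episode A k)]).real
              (Bandit.eventAt (Bandit.badStretch A T) (Bandit.episode A k))) ∧
    -- almost surely, this happens at infinitely many exploration episodes
    (∀ᵐ ω ∂P, ∃ᶠ k in atTop,
      ω ∈ Bandit.eventAt (Bandit.badStretch A T) (Bandit.episode A k)) := by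
  refine ⟨hrun.ae_slidingRegret_eq hμ₂ hμ hμ₁ T, fun a => Bandit.slidingRegret_le hμ.le a T,
    ⟨Bandit.goodStartEvent A R T, fun t _ => Bandit.measurableSet_goodStart A R T t,
      hrun.ae_eventually_eventAt hμ hμ₁ T, fun U hU k hne =>
        hrun.pow_le_cond_real hμ₂.le T k hU hne⟩,
    hrun.ae_frequently_badStretch hμ₂ hμ hμ₁ T⟩
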